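/- For an integer $N\ge 2$ and $E>0$ let $$\mathcal S_{N,E}=\Big\{\boldsymbol\eta\in[0,\infty)^N:\ \tfrac1N\sum_{k=1}^N\eta_k=E\Big\},$$ let $\sigma_{N,E}$ be the uniform probability measure on the simplex $\mathcal S_{N,E}$, and let $\mathcal H_{N,E}$ be the real Hilbert space $L^2(\mathcal S_{N,E},\sigma_{N,E})$, with inner product $\langle\cdot,\cdot\rangle$ and norm $\|\cdot\|_2$. For $i<j$ and $\alpha\in[0,1]$ let $\boldsymbol\eta^*_{i,j,\alpha}$ be the vector obtained from $\boldsymbol\eta$ by replacing $\eta_i$ with $(1-\alpha)(\eta_i+\eta_j)$ and $\eta_j$ with $\alpha(\eta_i+\eta_j)$, and put $[f]^{(i,j)}(\boldsymbol\eta)=\int_0^1 f(\boldsymbol\eta^*_{i,j,\alpha})\,d\alpha$. For $\gamma\in[0,1]$, the generator of the stochastic exchange process is $$L_{\gamma,N,E}f(\boldsymbol\eta)=-N\binom N2^{-1}\sum_{i<j}(\eta_i+\eta_j)^\gamma\Big[f(\boldsymbol\eta)-[f]^{(i,j)}(\boldsymbol\eta)\Big],$$ its Dirichlet form is $\mathcal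 E_{\gamma,N,E}(f,f)=-\langle f,L_{\gamma,N,E}f\rangle$ for $f\in\mathcal H_{N,E}$, and its spectral gap is $$\Delta_{\gamma,N,E}=\inf\{\mathcal E_{\gamma,N,E}(f,f):\ f\in\mathcal H_{N,E},\ \|f\|_2=1,\ \langle f,1\rangle=0\}.$$ Write $\Delta_{\gamma,N}=\Delta_{\gamma,N,1}$. **Lemma.** For every $\gamma\in[0,1]$ there is a constant $C>0$, depending only on $\gamma$, such that for all integers $N\ge 3$ $$\Delta_{\gamma,N}\ \ge\ C\,N^{\gamma-1}.$$ -/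

import Mathlib

open MeasureTheory

noncomputable section

namespace StochasticExchange

/-- The state space of `N` particles with mean energy `E` per particle: the simplex of all
`η ∈ ℝ^N` with nonnegative entries and `∑ k, η k = N * E`. -/
def stateSpace (N : ℕ) (E : ℝ) : Set (Fin N → ℝ) :=
  {η | (∀ k, 0 ≤ η k) ∧ ∑ k, η k = N * E}

/-- The affine parametrization of the hyperplane `{η | ∑ k, η k = N * E}` by its first `N - 1`
coordinates, `x ↦ (x_1, …, x_{N-1}, N * E - ∑ j, x_j)`. -/
def chart (N : ℕ) (E : ℝ) (x : Fin (N - 1) → ℝ) : Fin N → ℝ :=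
  fun k => if h : k.val < N - 1 then x ⟨k.val, h⟩ else N * E - ∑ j, x j

/-- The uniform probability measure on `stateSpace N E` (a flat Dirichlet distribution, scaled
by `N * E`), as a measure on `ℝ^N` concentrated on `stateSpace N E`: the image, under the affine
(hence constant-Jacobian) parametrization `chart N E`, of Lebesgue measure restricted to the
parameters of points of `stateSpace N E` and normalized to total mass one. -/
def uniformMeasure (N : ℕ) (E : ℝ) : Measure (Fin N → ℝ) :=
  (ProbabilityTheory.cond volume (chart N E ⁻¹' stateSpace N E)).map (chart N E)

/-- The configuration after an exchange between the particles `i ≠ j`, in which `j` receives the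
fraction `α` of their total energy `η i + η j`, and `i` receives the rest. -/
def exchange {N : ℕ} (i j : Fin N) (α : ℝ) (η : Fin N → ℝ) : Fin N → ℝ :=
  fun k => if k = i then (1 - α) * (η i + η j) else if k = j then α * (η i + η j) else η k

/-- `[f]^{(i,j)}`: the mean of `f` over the outcome of an exchange between `i` and `j`, with the
fraction `α` uniformly distributed on `[0, 1]`. -/
def pairAverage {N : ℕ} (i j : Fin N) (f : (Fin N → ℝ) → ℝ) (η : Fin N → ℝ) : ℝ :=
  ∫ α in (0 : ℝ)..1, f (exchange i j α η)

/-- The generator of the stochastic exchange process, in which the pair `i < j` exchanges energy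
at rate `N * (N choose 2)⁻¹ * (η i + η j) ^ γ`. -/
def generator (γ : ℝ) (N : ℕ) (f : (Fin N → ℝ) → ℝ) (η : Fin N → ℝ) : ℝ :=
  -((N : ℝ) * ((N.choose 2 : ℕ) : ℝ)⁻¹ *
    ∑ i : Fin N, ∑ j ∈ Finset.Ioi i, (η i + η j) ^ γ * (f η - pairAverage i j f η))

/-- The Dirichlet form `-⟨f, L f⟩`, with the inner product of `L²(uniformMeasure N E)`. -/
def dirichletForm (γ : ℝ) (N : ℕ) (E : ℝ) (f : (Fin N → ℝ) → ℝ) : ℝ :=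
  -∫ η, f η * generator γ N f η ∂(uniformMeasure N E)

/-- The spectral gap at mean energy `E`: the infimum of the Dirichlet form over all `f` in the
real Hilbert space `L²(uniformMeasure N E)` with norm one that are orthogonal to the constants. -/
def spectralGapAt (γ : ℝ) (N : ℕ) (E : ℝ) : ℝ :=
  sInf {a : ℝ | ∃ f : Lp ℝ 2 (uniformMeasure N E),
    ‖f‖ = 1 ∧ ∫ η, f η ∂(uniformMeasure N E) = 0 ∧ a = dirichletForm γ N E f}

/-- The spectral gap at unit mean energy per particle. -/
def spectralGap (γ : ℝ) (N : ℕ) : ℝ := spectralGapAt γ N 1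

end StochasticExchange

end

noncomputable section

namespace StochasticExchange

open Set ENNReal

/-! The exponent `γ` is reduced to `0` in two comparisons, after which the gap at constant rate is
found by coupling. On the simplex with total energy `N`, a pair energy `s` lies in `[0, N]`, so `s ^
γ ≥ N ^ (γ - 1) * s`. This gives the factor `N ^ (γ - 1)` and leaves the rates `η i + η j`.

These rates degenerate when a pair has little energy. Since `∑ k, η k = N`, however, `N` times the
constant-rate form of `(i, j)` is the sum over `k` of its forms at rate `η k`. If `η k` exceeds `η i
+ η j`, the exchange can be routed through the rich particle `k`: exchanging `(k, i)` and then `(k,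
j)`, both at high energy, resamples the energies of `i` and `j` and forgets how they were split.
This is `exchangeForm_three_body`; summing it costs a factor `81` in `sum_exchangeForm_one_le`.

At constant rate, two copies run with the same pair and the same fraction come closer in mean
squared Euclidean distance by the factor `contractionRate N`, so the averaged exchange operator
contracts squared Lipschitz constants. The operator is symmetric, so the squared norms of its
iterates are log-convex, and their geometric decay for a Lipschitz function of mean zero already
bounds the first ratio (`integral_mul_exchangeAverage_le`). Density extends the inequality to all of
`L²` (`norm_sq_le_sum_exchangeForm`). Symmetry, and every change of variables, rests on the
invariance of the uniform measure under exchanges (`lintegral_exchange`). -/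

/-! ### Redistributing a sum on the positive quadrant -/

lemma lintegral_Icc_eq_ofReal_mul (g : ℝ → ℝ≥0∞) (hg : Measurable g) {s : ℝ} (hs : 0 ≤ s) :
    ∫⁻ b in Icc 0 s, g b = ENNReal.ofReal s * ∫⁻ α in Icc (0 : ℝ) 1, g (α * s) := by
  rcases hs.eq_or_lt with rfl | hs
  · simp
  · rw [← lintegral_indicator measurableSet_Icc, ← lintegral_indicator measurableSet_Icc]
    conv_lhs => rw [← Real.smul_map_volume_mul_right hs.ne']
    rw [lintegral_smul_measure, lintegral_map (hg.indicator measurableSet_Icc) (by fun_prop),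
      abs_of_pos hs, smul_eq_mul]
    congr 2
    ext α
    have : α * s ∈ Icc 0 s ↔ α ∈ Icc (0 : ℝ) 1 := by
      simp only [mem_Icc]
      constructor
      · rintro ⟨h1, h2⟩; exact ⟨by nlinarith, by nlinarith⟩
      · rintro ⟨h1, h2⟩; exact ⟨by positivity, by nlinarith⟩
    by_cases h : α ∈ Icc (0 : ℝ) 1
    · rw [indicator_of_mem h, indicator_of_mem (this.2 h)]
    · rw [indicator_of_notMem h, indicator_of_notMem (mt this.1 h)]

/-- Integration over the positive quadrant along the segments `a + b = s`. -/
lemma lintegral_quadrant (H : ℝ → ℝ → ℝ≥0∞) (hH : Measurable (Function.uncurry H)) :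
    ∫⁻ a in Ici (0 : ℝ), ∫⁻ b in Ici (0 : ℝ), H a b =
      ∫⁻ s in Ici (0 : ℝ), ENNReal.ofReal s *
        ∫⁻ α in Icc (0 : ℝ) 1, H ((1 - α) * s) (α * s) := by
  have hH' : ∀ {γ : Type} [MeasurableSpace γ] {u v : γ → ℝ}, Measurable u → Measurable v →
      Measurable fun x => H (u x) (v x) := fun hu hv => hH.comp (hu.prodMk hv)
  have hQ : MeasurableSet {p : ℝ × ℝ | 0 ≤ p.1 ∧ 0 ≤ p.2} :=
    (measurableSet_le measurable_const measurable_fst).inter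
      (measurableSet_le measurable_const measurable_snd)
  set K : ℝ → ℝ → ℝ≥0∞ := fun a b => {p : ℝ × ℝ | 0 ≤ p.1 ∧ 0 ≤ p.2}.indicator
    (Function.uncurry H) (a, b) with hK
  have hKm : Measurable (Function.uncurry K) := hH.indicator hQ
  have h1 : ∫⁻ a in Ici (0 : ℝ), ∫⁻ b in Ici (0 : ℝ), H a b = ∫⁻ a, ∫⁻ b, K a b := by
    rw [← lintegral_indicator measurableSet_Ici]
    congr 1; ext a
    by_cases ha : 0 ≤ a
    · rw [indicator_of_mem (mem_Ici.2 ha), ← lintegral_indicator measurableSet_Ici]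
      congr 1; ext b
      by_cases hb : 0 ≤ b <;> simp [hK, indicator, ha, hb]
    · rw [indicator_of_notMem (by simpa using ha)]
      simp [hK, indicator, ha]
  -- The shear `a = s - b` preserves Lebesgue measure; the factor `s` appears only later, on
  -- rescaling `b = α * s`.
  have h2 : ∫⁻ a, ∫⁻ b, K a b = ∫⁻ s, ∫⁻ b, K (s - b) b := by
    rw [lintegral_lintegral_swap hKm.aemeasurable]
    rw [lintegral_lintegral_swap (f := fun s b => K (s - b) b)]
    · congr 1; ext b
      exact (lintegral_sub_right_eq_self (fun a => K a b) b).symm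
    · exact (hKm.comp ((measurable_fst.sub measurable_snd).prodMk measurable_snd)).aemeasurable
  rw [h1, h2, ← lintegral_indicator measurableSet_Ici]
  congr 1; ext s
  by_cases hs : 0 ≤ s
  · rw [indicator_of_mem (mem_Ici.2 hs)]
    have := lintegral_Icc_eq_ofReal_mul (fun b => H (s - b) b)
      (hH' (measurable_const.sub measurable_id) measurable_id) hs
    simp only [show ∀ α : ℝ, s - α * s = (1 - α) * s from fun α => by ring] at this
    rw [← this, ← lintegral_indicator measurableSet_Icc]
    congr 1; ext b
    by_cases hb : b ∈ Icc 0 s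
    · rw [indicator_of_mem hb]
      have : ((s - b, b) : ℝ × ℝ) ∈ {p : ℝ × ℝ | 0 ≤ p.1 ∧ 0 ≤ p.2} :=
        ⟨by simpa using hb.2, hb.1⟩
      exact indicator_of_mem this (Function.uncurry H)
    · rw [indicator_of_notMem hb]
      have : ((s - b, b) : ℝ × ℝ) ∉ {p : ℝ × ℝ | 0 ≤ p.1 ∧ 0 ≤ p.2} :=
        fun h => hb ⟨h.2, by simpa using h.1⟩
      exact indicator_of_notMem this (Function.uncurry H)
  · rw [indicator_of_notMem (by simpa using hs)]
    simp only [hK]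
    rw [lintegral_eq_zero_iff]
    · refine Filter.Eventually.of_forall fun b => indicator_of_notMem (fun h => hs ?_) _
      have h1 := h.1
      have h2 := h.2
      simp at h1 h2
      linarith
    · exact hKm.comp ((measurable_const.sub measurable_id).prodMk measurable_id)

/-- Redistributing the sum `a + b` uniformly preserves Lebesgue measure on the quadrant. -/
lemma lintegral_quadrant_redistribute (H : ℝ → ℝ → ℝ≥0∞) (hH : Measurable (Function.uncurry H)) :
    ∫⁻ a in Ici (0 : ℝ), ∫⁻ b in Ici (0 : ℝ),
        ∫⁻ α in Icc (0 : ℝ) 1, H ((1 - α) * (a + b)) (α * (a + b)) =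
      ∫⁻ a in Ici (0 : ℝ), ∫⁻ b in Ici (0 : ℝ), H a b := by
  have hm : Measurable fun s : ℝ => ∫⁻ α in Icc (0 : ℝ) 1, H ((1 - α) * s) (α * s) := by
    refine Measurable.lintegral_prod_right' (f := fun p : ℝ × ℝ => H ((1 - p.2) * p.1) (p.2 * p.1)) ?_
    have : Measurable fun p : ℝ × ℝ => ((1 - p.2) * p.1, p.2 * p.1) := by fun_prop
    exact hH.comp this
  rw [lintegral_quadrant H hH,
    lintegral_quadrant (fun a b => ∫⁻ α in Icc (0 : ℝ) 1, H ((1 - α) * (a + b)) (α * (a + b)))]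
  -- The averaged integrand depends on `a + b` alone, so a second average over the segment does
  -- nothing.
  · congr 1; ext s
    simp only [show ∀ α : ℝ, (1 - α) * s + α * s = s from fun α => by ring]
    rw [setLIntegral_const]
    simp
  · exact hm.comp (measurable_fst.add measurable_snd)

/-! ### The exchange map and the simplex -/

section Exchange

variable {N : ℕ}

lemma exchange_left (i j : Fin N) (α : ℝ) (η : Fin N → ℝ) :
    exchange i j α η i = (1 - α) * (η i + η j) := by simp [exchange]

lemma exchange_right {i j : Fin N} (h : i ≠ j) (α : ℝ) (η : Fin N → ℝ) :
    exchange i j α η j = α * (η i + η j) := by simp [exchange, h.symm]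

lemma exchange_of_ne {i j k : Fin N} (hi : k ≠ i) (hj : k ≠ j) (α : ℝ) (η : Fin N → ℝ) :
    exchange i j α η k = η k := by simp [exchange, hi, hj]

lemma exchange_add {i j : Fin N} (h : i ≠ j) (α : ℝ) (η : Fin N → ℝ) :
    exchange i j α η i + exchange i j α η j = η i + η j := by
  rw [exchange_left, exchange_right h]; ring

/-- An exchange sees the pair only through its total, which makes `pairAverage` idempotent. -/
lemma exchange_exchange {i j : Fin N} (h : i ≠ j) (α β : ℝ) (η : Fin N → ℝ) :
    exchange i j β (exchange i j α η) = exchange i j β η := by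
  ext k
  simp only [exchange, if_true, h.symm, if_false]
  split_ifs <;> ring

lemma sum_eq_add_add {i j : Fin N} (h : i ≠ j) (g : Fin N → ℝ) :
    ∑ k, g k = g i + g j + ∑ k ∈ (Finset.univ.erase i).erase j, g k := by
  rw [add_assoc, Finset.add_sum_erase _ _ (by simp [h.symm]), Finset.add_sum_erase _ _ (by simp)]

lemma sum_exchange {i j : Fin N} (h : i ≠ j) (α : ℝ) (η : Fin N → ℝ) :
    ∑ k, exchange i j α η k = ∑ k, η k := by
  rw [sum_eq_add_add h, sum_eq_add_add h, exchange_add h]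
  congr 1
  refine Finset.sum_congr rfl fun k hk => exchange_of_ne ?_ ?_ α η <;> simp_all

lemma exchange_mem {i j : Fin N} (h : i ≠ j) {E α : ℝ} (hα : α ∈ Icc (0 : ℝ) 1) {η : Fin N → ℝ}
    (hη : η ∈ stateSpace N E) : exchange i j α η ∈ stateSpace N E := by
  refine ⟨fun k => ?_, (sum_exchange h α η).trans hη.2⟩
  have h1 := hη.1
  have h2 : 0 ≤ η i + η j := add_nonneg (h1 i) (h1 j)
  have h3 : 0 ≤ 1 - α := by linarith [hα.2]
  have h4 := hα.1
  unfold exchange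
  split_ifs
  · positivity
  · positivity
  · exact h1 k

lemma continuous_exchange (i j : Fin N) :
    Continuous fun p : (Fin N → ℝ) × ℝ => exchange i j p.2 p.1 := by
  refine continuous_pi fun k => ?_
  unfold exchange
  split_ifs <;> fun_prop

lemma measurable_exchange (i j : Fin N) :
    Measurable fun p : (Fin N → ℝ) × ℝ => exchange i j p.2 p.1 := (continuous_exchange i j).measurable

lemma exchange_perm (σ : Equiv.Perm (Fin N)) (i j : Fin N) (α : ℝ) (η : Fin N → ℝ) :
    exchange (σ i) (σ j) α η ∘ σ = exchange i j α (η ∘ σ) := by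
  ext k; simp [exchange]

lemma isClosed_stateSpace (N : ℕ) (E : ℝ) : IsClosed (stateSpace N E) := by
  have : stateSpace N E = (⋂ k, {η | 0 ≤ η k}) ∩ {η | ∑ k, η k = N * E} := by
    ext; simp [stateSpace]
  rw [this]
  exact (isClosed_iInter fun k => isClosed_le continuous_const (continuous_apply k)).inter
    (isClosed_eq (by fun_prop) continuous_const)

lemma le_of_mem_stateSpace {E : ℝ} {η : Fin N → ℝ} (hη : η ∈ stateSpace N E) (k : Fin N) :
    η k ≤ N * E := by
  rw [← hη.2]; exact Finset.single_le_sum (fun i _ => hη.1 i) (Finset.mem_univ k)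

lemma add_le_of_mem_stateSpace {E : ℝ} {η : Fin N → ℝ} (hη : η ∈ stateSpace N E) {i j : Fin N}
    (h : i ≠ j) : η i + η j ≤ N * E := by
  rw [← hη.2, sum_eq_add_add h]
  linarith [Finset.sum_nonneg (s := (Finset.univ.erase i).erase j) fun k _ => hη.1 k]

lemma isCompact_stateSpace (N : ℕ) (E : ℝ) : IsCompact (stateSpace N E) := by
  refine (isCompact_univ_pi fun _ : Fin N => isCompact_Icc (a := (0 : ℝ)) (b := N * E)).of_isClosed_subset
    (isClosed_stateSpace N E) fun η hη k _ => ⟨hη.1 k, le_of_mem_stateSpace hη k⟩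

end Exchange

/-! ### Invariance of the uniform measure under exchanges -/

section Chart

variable {n : ℕ} {E : ℝ}

lemma chart_castSucc (x : Fin n → ℝ) (i : Fin n) : chart (n + 1) E x i.castSucc = x i := by
  simp [chart]

lemma chart_last (x : Fin n → ℝ) :
    chart (n + 1) E x (Fin.last n) = ((n + 1 : ℕ) : ℝ) * E - ∑ j, x j := by
  simp [chart]

lemma continuous_chart (N : ℕ) (E : ℝ) : Continuous (chart N E) := by
  refine continuous_pi fun k => ?_
  unfold chart
  split_ifs <;> fun_prop

lemma sum_chart (x : Fin n → ℝ) : ∑ k, chart (n + 1) E x k = ((n + 1 : ℕ) : ℝ) * E := by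
  rw [Fin.sum_univ_castSucc, chart_last]
  simp_rw [chart_castSucc]
  ring

lemma chart_mem_iff (x : Fin n → ℝ) : chart (n + 1) E x ∈ stateSpace (n + 1) E ↔
    (∀ i, 0 ≤ x i) ∧ ∑ i, x i ≤ ((n + 1 : ℕ) : ℝ) * E := by
  constructor
  · intro h
    refine ⟨fun i => by simpa [chart_castSucc] using h.1 i.castSucc, ?_⟩
    have := h.1 (Fin.last n)
    rw [chart_last] at this
    linarith
  · rintro ⟨h1, h2⟩
    refine ⟨fun k => ?_, sum_chart x⟩
    induction k using Fin.lastCases with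
    | last => rw [chart_last]; linarith
    | cast i => rw [chart_castSucc]; exact h1 i

lemma measurableSet_chart_preimage (N : ℕ) (E : ℝ) :
    MeasurableSet (chart N E ⁻¹' stateSpace N E) :=
  (continuous_chart N E).measurable (isClosed_stateSpace N E).measurableSet

lemma volume_chart_preimage_ne_top :
    volume ((chart (n + 1) E ⁻¹' stateSpace (n + 1) E : Set (Fin n → ℝ))) ≠ ⊤ := by
  have hc := isCompact_univ_pi fun _ : Fin n =>
    isCompact_Icc (a := (0 : ℝ)) (b := ((n + 1 : ℕ) : ℝ) * E)
  refine (lt_of_le_of_lt ?_ (hc.measure_lt_top (μ := volume))).ne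
  refine measure_mono fun x hx k _ => ?_
  have := (chart_mem_iff x).1 hx
  exact ⟨this.1 k, (Finset.single_le_sum (fun i _ => this.1 i) (Finset.mem_univ k)).trans this.2⟩

lemma volume_chart_preimage_ne_zero (hE : 0 < E) :
    volume ((chart (n + 1) E ⁻¹' stateSpace (n + 1) E : Set (Fin n → ℝ))) ≠ 0 := by
  have hsub : (Set.univ.pi fun _ : Fin n => Icc 0 E) ⊆
      (chart (n + 1) E ⁻¹' stateSpace (n + 1) E : Set (Fin n → ℝ)) := by
    intro x hx
    refine (chart_mem_iff x).2 ⟨fun i => (hx i trivial).1, ?_⟩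
    refine (Finset.sum_le_sum fun i _ => (hx i trivial).2).trans ?_
    simp; linarith
  intro h
  have h0 := measure_mono_null hsub h
  rw [volume_pi_pi] at h0
  simp [hE.not_ge] at h0

lemma isProbabilityMeasure_uniformMeasure {N : ℕ} (hN : N ≠ 0) (hE : 0 < E) :
    IsProbabilityMeasure (uniformMeasure N E) := by
  obtain ⟨n, rfl⟩ := Nat.exists_eq_succ_of_ne_zero hN
  have := ProbabilityTheory.cond_isProbabilityMeasure_of_finite
    (volume_chart_preimage_ne_zero (n := n) hE) volume_chart_preimage_ne_top
  exact Measure.isProbabilityMeasure_map (continuous_chart _ _).measurable.aemeasurable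

lemma ae_mem_stateSpace (N : ℕ) (E : ℝ) : ∀ᵐ η ∂uniformMeasure N E, η ∈ stateSpace N E := by
  refine (ae_map_iff (p := fun η => η ∈ stateSpace N E)
    (continuous_chart _ _).measurable.aemeasurable (isClosed_stateSpace N E).measurableSet).2 ?_
  exact ProbabilityTheory.ae_cond_mem (measurableSet_chart_preimage N E)

lemma lintegral_uniformMeasure {F : (Fin (n + 1) → ℝ) → ℝ≥0∞} (hF : Measurable F) :
    ∫⁻ η, F η ∂uniformMeasure (n + 1) E =
      (volume (chart (n + 1) E ⁻¹' stateSpace (n + 1) E))⁻¹ *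
        ∫⁻ x : Fin n → ℝ, (chart (n + 1) E ⁻¹' stateSpace (n + 1) E).indicator
          (fun x => F (chart (n + 1) E x)) x := by
  unfold uniformMeasure
  rw [lintegral_map hF (continuous_chart _ _).measurable, ProbabilityTheory.cond,
    lintegral_smul_measure]
  exact congrArg _ (lintegral_indicator (measurableSet_chart_preimage (n + 1) E) _).symm

/-- Each of the parametrizations of the simplex that omit one coordinate gives the same measure. -/
lemma map_swap_last_uniformMeasure (k : Fin n) :
    (uniformMeasure (n + 1) E).map (fun η => η ∘ Equiv.swap k.castSucc (Fin.last n)) =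
      uniformMeasure (n + 1) E := by
  classical
  have hm : Measurable fun η : Fin (n + 1) → ℝ => η ∘ Equiv.swap k.castSucc (Fin.last n) := by
    fun_prop
  refine Measure.ext_of_lintegral _ fun F hF => ?_
  rw [lintegral_map hF hm, lintegral_uniformMeasure hF]
  refine (lintegral_uniformMeasure (hF.comp hm)).trans ?_
  congr 1
  set D : Set (Fin n → ℝ) := chart (n + 1) E ⁻¹' stateSpace (n + 1) E with hD
  have hDm : MeasurableSet D := measurableSet_chart_preimage (n + 1) E
  set G : (Fin n → ℝ) → ℝ≥0∞ := D.indicator (fun x => F (chart (n + 1) E x)) with hG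
  have hGm : Measurable G := (hF.comp (continuous_chart (n + 1) E).measurable).indicator hDm
  -- `T` is the swap read in the chart: it replaces coordinate `k` by the omitted coordinate.
  set T : (Fin n → ℝ) → (Fin n → ℝ) :=
    fun x => Function.update x k (((n + 1 : ℕ) : ℝ) * E - ∑ j, x j) with hT
  have hTm : Measurable T := by
    refine measurable_pi_lambda _ fun j => ?_
    by_cases h : j = k
    · subst h; simp only [hT, Function.update_self]; fun_prop
    · simp only [hT, Function.update_of_ne h]; fun_prop
  have hsum : ∀ x : Fin n → ℝ, ∑ j, x j = x k + ∑ j ∈ Finset.univ.erase k, x j := fun x =>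
    (Finset.add_sum_erase _ _ (Finset.mem_univ k)).symm
  have hsumT : ∀ (x : Fin n → ℝ) (t : ℝ), ∑ j, Function.update x k t j =
      t + ∑ j ∈ Finset.univ.erase k, x j := by
    intro x t
    rw [hsum, Function.update_self]
    congr 1
    exact Finset.sum_congr rfl fun j hj => Function.update_of_ne (Finset.ne_of_mem_erase hj) _ _
  have hchart : ∀ x : Fin n → ℝ, chart (n + 1) E x ∘ Equiv.swap k.castSucc (Fin.last n) =
      chart (n + 1) E (T x) := by
    intro x
    ext j
    induction j using Fin.lastCases with
    | last =>
      rw [Function.comp, Equiv.swap_apply_right, chart_last, chart_castSucc, hT]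
      simp only [hsumT, hsum]; ring
    | cast i =>
      by_cases h : i = k
      · subst h
        rw [Function.comp, Equiv.swap_apply_left, chart_last, chart_castSucc, hT]
        simp
      · rw [Function.comp, Equiv.swap_apply_of_ne_of_ne (by simpa using h)
          (Fin.castSucc_lt_last i).ne, chart_castSucc, chart_castSucc, hT]
        simp [h]
  have hmemT : ∀ x, T x ∈ D ↔ x ∈ D := by
    intro x
    rw [hD, mem_preimage, mem_preimage, ← hchart]
    constructor
    · rintro ⟨h1, _⟩
      refine ⟨fun j => ?_, sum_chart x⟩
      simpa using h1 (Equiv.swap k.castSucc (Fin.last n) j)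
    · rintro ⟨h1, _⟩
      refine ⟨fun j => h1 _, ?_⟩
      rw [hchart]; exact sum_chart _
  have hGT : ∀ x, D.indicator (fun x => (F ∘ fun η => η ∘ Equiv.swap k.castSucc (Fin.last n))
      (chart (n + 1) E x)) x = G (T x) := by
    intro x
    by_cases h : x ∈ D
    · rw [indicator_of_mem h, hG, indicator_of_mem ((hmemT x).2 h), Function.comp, hchart]
    · rw [indicator_of_notMem h, hG, indicator_of_notMem (mt (hmemT x).1 h)]
  calc _ = ∫⁻ x, G (T x) := lintegral_congr hGT
    _ = ∫⁻ x, G x := by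
      rw [volume_pi, lintegral_eq_lmarginal_univ (0 : Fin n → ℝ),
        lintegral_eq_lmarginal_univ (0 : Fin n → ℝ)]
      -- With the other coordinates fixed, `T` acts on coordinate `k` as a reflection `t ↦ c - t`,
      -- so integrating this one variable first suffices.
      refine congrFun (lmarginal_eq_of_subset (Finset.subset_univ {k}) (hGm.comp hTm) hGm ?_) _
      ext x
      rw [lmarginal_singleton, lmarginal_singleton]
      have : ∀ t, G (T (Function.update x k t)) = G (Function.update x k
          ((((n + 1 : ℕ) : ℝ) * E - ∑ j ∈ Finset.univ.erase k, x j) - t)) := by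
        intro t
        simp only [hT, hsumT, Function.update_idem]
        congr 2; ring
      refine (lintegral_congr this).trans ?_
      exact lintegral_sub_left_eq_self (fun t => G (Function.update x k t)) _

/-- For two chart coordinates the exchange leaves the omitted coordinate alone, so integrating those
two variables first reduces the claim to redistribution on the quadrant. -/
lemma lintegral_exchange_castSucc {i j : Fin n} (hij : i ≠ j) {F : (Fin (n + 1) → ℝ) → ℝ≥0∞}
    (hF : Measurable F) :
    ∫⁻ η, (∫⁻ α in Icc (0 : ℝ) 1, F (exchange i.castSucc j.castSucc α η)) ∂uniformMeasure (n + 1) E =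
      ∫⁻ η, F η ∂uniformMeasure (n + 1) E := by
  classical
  have hF2 : Measurable fun η => ∫⁻ α in Icc (0 : ℝ) 1,
      F (exchange i.castSucc j.castSucc α η) :=
    (hF.comp (measurable_exchange _ _)).lintegral_prod_right'
  rw [lintegral_uniformMeasure hF2, lintegral_uniformMeasure hF]
  congr 1
  have hDm := measurableSet_chart_preimage (n + 1) E
  have hc := (continuous_chart (n + 1) E).measurable
  rw [volume_pi, lintegral_eq_lmarginal_univ (0 : Fin n → ℝ),
    lintegral_eq_lmarginal_univ (0 : Fin n → ℝ)]
  refine congrFun (lmarginal_eq_of_subset (Finset.subset_univ {i, j})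
    ((hF2.comp hc).indicator hDm) ((hF.comp hc).indicator hDm) ?_) _
  ext x
  rw [lmarginal_insert _ ((hF2.comp hc).indicator hDm) (by simpa using hij),
    lmarginal_insert _ ((hF.comp hc).indicator hDm) (by simpa using hij)]
  simp_rw [lmarginal_singleton]
  set y : ℝ → ℝ → Fin n → ℝ := fun a b => Function.update (Function.update x i a) j b with hy
  have hyi : ∀ a b, y a b i = a := fun a b => by simp [hy, hij]
  have hyj : ∀ a b, y a b j = b := fun a b => by simp [hy]
  have hyk : ∀ a b k, k ≠ i → k ≠ j → y a b k = x k := fun a b k h1 h2 => by simp [hy, h1, h2]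
  have hym : Measurable (Function.uncurry y) := by
    refine measurable_pi_lambda _ fun k => ?_
    by_cases h1 : k = i
    · subst h1; simp only [Function.uncurry_def, hyi]; fun_prop
    by_cases h2 : k = j
    · subst h2; simp only [Function.uncurry_def, hyj]; fun_prop
    · simp only [Function.uncurry_def, hyk _ _ k h1 h2]; fun_prop
  have hyex : ∀ a b α, y ((1 - α) * (a + b)) (α * (a + b)) = exchange i j α (y a b) := by
    intro a b α
    ext k
    by_cases h1 : k = i
    · subst h1; rw [hyi, exchange_left, hyi, hyj]
    by_cases h2 : k = j
    · subst h2; rw [hyj, exchange_right hij, hyi, hyj]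
    · rw [hyk _ _ k h1 h2, exchange_of_ne h1 h2, hyk _ _ k h1 h2]
  have hchart : ∀ (z : Fin n → ℝ) α, exchange i.castSucc j.castSucc α (chart (n + 1) E z) =
      chart (n + 1) E (exchange i j α z) := by
    intro z α
    ext k
    induction k using Fin.lastCases with
    | last =>
      rw [exchange_of_ne (Fin.castSucc_lt_last i).ne' (Fin.castSucc_lt_last j).ne', chart_last,
        chart_last, sum_exchange hij]
    | cast k =>
      rw [chart_castSucc]
      simp [exchange, chart_castSucc]
  -- `R` keeps the constraints that the exchange of `i` and `j` cannot affect; the dropped ones,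
  -- nonnegativity at `i` and `j`, are the quadrant.
  set R : Set (Fin n → ℝ) := {z | (∀ k, k ≠ i → k ≠ j → 0 ≤ z k) ∧
    ∑ k, z k ≤ ((n + 1 : ℕ) : ℝ) * E} with hR
  have hRm : MeasurableSet R := by
    have : R = (⋂ k, ⋂ (_ : k ≠ i), ⋂ (_ : k ≠ j), {z | 0 ≤ z k}) ∩
      {z | ∑ k, z k ≤ ((n + 1 : ℕ) : ℝ) * E} := by ext; simp [hR]
    rw [this]
    refine MeasurableSet.inter (MeasurableSet.iInter fun k => MeasurableSet.iInter fun _ =>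
      MeasurableSet.iInter fun _ => measurableSet_le measurable_const (measurable_pi_apply k)) ?_
    exact measurableSet_le (by fun_prop) measurable_const
  have hRex : ∀ z α, exchange i j α z ∈ R ↔ z ∈ R := by
    intro z α
    simp only [hR, mem_ofPred_eq, sum_exchange hij]
    refine and_congr_left fun _ => forall_congr' fun k => ?_
    refine forall_congr' fun h1 => forall_congr' fun h2 => ?_
    rw [exchange_of_ne h1 h2]
  have hDR : ∀ a b, (y a b ∈ chart (n + 1) E ⁻¹' stateSpace (n + 1) E) ↔
      0 ≤ a ∧ 0 ≤ b ∧ y a b ∈ R := by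
    intro a b
    rw [mem_preimage, chart_mem_iff]
    constructor
    · rintro ⟨h1, h2⟩
      exact ⟨by simpa [hyi] using h1 i, by simpa [hyj] using h1 j, fun k _ _ => h1 k, h2⟩
    · rintro ⟨h1, h2, h3, h4⟩
      refine ⟨fun k => ?_, h4⟩
      by_cases hk1 : k = i
      · subst hk1; rwa [hyi]
      by_cases hk2 : k = j
      · subst hk2; rwa [hyj]
      exact h3 k hk1 hk2
  have key : ∀ Φ : (Fin n → ℝ) → ℝ≥0∞,
      ∫⁻ a, ∫⁻ b, (chart (n + 1) E ⁻¹' stateSpace (n + 1) E).indicator Φ (y a b) =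
      ∫⁻ a in Ici (0 : ℝ), ∫⁻ b in Ici (0 : ℝ), R.indicator Φ (y a b) := by
    intro Φ
    rw [← lintegral_indicator measurableSet_Ici]
    congr 1; ext a
    by_cases ha : 0 ≤ a
    · rw [indicator_of_mem (mem_Ici.2 ha), ← lintegral_indicator measurableSet_Ici]
      congr 1; ext b
      simp only [indicator, hDR, mem_Ici, ha, true_and]
      by_cases hb : 0 ≤ b <;> simp [hb]
    · rw [indicator_of_notMem (by simpa using ha)]
      simp [indicator, hDR, ha]
  have hH : Measurable (Function.uncurry fun a b =>
      R.indicator (fun z => F (chart (n + 1) E z)) (y a b)) :=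
    ((hF.comp hc).indicator hRm).comp hym
  have := lintegral_quadrant_redistribute _ hH
  refine (key _).trans (Eq.trans ?_ (this.trans (key _).symm))
  congr 1; ext a; congr 1; ext b
  simp only [hyex]
  by_cases h : y a b ∈ R
  · simp [indicator, hRex, h, hchart]
  · simp [indicator, hRex, h]

end Chart

/-- The uniform measure is invariant under the exchange between two particles with a uniformly
distributed fraction. -/
lemma lintegral_exchange {N : ℕ} (hN : 3 ≤ N) {E : ℝ} {i j : Fin N} (hij : i ≠ j)
    {F : (Fin N → ℝ) → ℝ≥0∞} (hF : Measurable F) :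
    ∫⁻ η, (∫⁻ α in Icc (0 : ℝ) 1, F (exchange i j α η)) ∂uniformMeasure N E =
      ∫⁻ η, F η ∂uniformMeasure N E := by
  classical
  obtain ⟨n, rfl⟩ : ∃ n, N = n + 1 := ⟨N - 1, by omega⟩
  -- A pair containing the last particle is moved into the chart coordinates by swapping that
  -- particle with some `k` outside the pair; `3 ≤ N` provides such a `k`.
  have key : ∀ (k : Fin n) (i' j' : Fin n), i' ≠ j' →
      i = Equiv.swap k.castSucc (Fin.last n) i'.castSucc →
      j = Equiv.swap k.castSucc (Fin.last n) j'.castSucc →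
      ∫⁻ η, (∫⁻ α in Icc (0 : ℝ) 1, F (exchange i j α η)) ∂uniformMeasure (n + 1) E =
        ∫⁻ η, F η ∂uniformMeasure (n + 1) E := by
    intro k i' j' hij' hi hj
    set σ := Equiv.swap k.castSucc (Fin.last n) with hσ
    have hm : Measurable fun η : Fin (n + 1) → ℝ => η ∘ σ := by fun_prop
    have hinv : ∀ η : Fin (n + 1) → ℝ, (η ∘ σ) ∘ σ = η := by
      intro η; ext a; simp [hσ]
    have h1 : ∀ {G : (Fin (n + 1) → ℝ) → ℝ≥0∞}, Measurable G →
        ∫⁻ η, G (η ∘ σ) ∂uniformMeasure (n + 1) E = ∫⁻ η, G η ∂uniformMeasure (n + 1) E := by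
      intro G hG
      conv_rhs => rw [← map_swap_last_uniformMeasure k, lintegral_map hG hm]
    have h2 : ∀ η α, F (exchange i j α η) =
        F (exchange i'.castSucc j'.castSucc α (η ∘ σ) ∘ σ) := by
      intro η α
      rw [← exchange_perm, ← hi, ← hj, hinv]
    simp_rw [h2]
    rw [h1 (G := fun η => ∫⁻ α in Icc (0 : ℝ) 1, F (exchange i'.castSucc j'.castSucc α η ∘ σ))]
    · exact (lintegral_exchange_castSucc hij' (hF.comp hm)).trans (h1 hF)
    · exact ((hF.comp hm).comp (measurable_exchange _ _)).lintegral_prod_right'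
  induction i using Fin.lastCases with
  | last =>
    induction j using Fin.lastCases with
    | last => exact absurd rfl hij
    | cast j =>
      obtain ⟨k, hk⟩ : ∃ k : Fin n, k ≠ j := by
        have : Nontrivial (Fin n) := Fin.nontrivial_iff_two_le.2 (by omega)
        exact exists_ne j
      refine key k k j hk (by simp) ?_
      rw [Equiv.swap_apply_of_ne_of_ne (by simpa using hk.symm) (Fin.castSucc_lt_last j).ne]
  | cast i =>
    induction j using Fin.lastCases with
    | last =>
      obtain ⟨k, hk⟩ : ∃ k : Fin n, k ≠ i := by
        have : Nontrivial (Fin n) := Fin.nontrivial_iff_two_le.2 (by omega)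
        exact exists_ne i
      refine key k i k hk.symm ?_ (by simp)
      rw [Equiv.swap_apply_of_ne_of_ne (by simpa using hk.symm) (Fin.castSucc_lt_last i).ne]
    | cast j => exact lintegral_exchange_castSucc (by simpa using hij) hF

/-! ### Exchange forms and the three-body comparison -/

/-- The uniform distribution of the fraction exchanged. -/
abbrev unitUniform : Measure ℝ := volume.restrict (Icc 0 1)

instance : IsProbabilityMeasure unitUniform := ⟨by simp⟩

/-- The squared distance of two reals. -/
def sqDist (a b : ℝ) : ℝ≥0∞ := ENNReal.ofReal ((a - b) ^ 2)

lemma sqDist_comm (a b : ℝ) : sqDist a b = sqDist b a := by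
  unfold sqDist; congr 1; ring

lemma sqDist_le (a b c : ℝ) : sqDist a b ≤ 2 * sqDist a c + 2 * sqDist c b := by
  unfold sqDist
  rw [show (2 : ℝ≥0∞) = ENNReal.ofReal 2 by simp, ← ENNReal.ofReal_mul (by norm_num),
    ← ENNReal.ofReal_mul (by norm_num), ← ENNReal.ofReal_add (by positivity) (by positivity)]
  exact ENNReal.ofReal_le_ofReal (by nlinarith [sq_nonneg (a - c - (c - b))])

lemma measurable_sqDist {X : Type*} [MeasurableSpace X] {u v : X → ℝ} (hu : Measurable u)
    (hv : Measurable v) : Measurable fun x => sqDist (u x) (v x) := by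
  unfold sqDist; fun_prop

variable {N : ℕ}

/-- Twice the Dirichlet form of the exchange between `i` and `j` at rate `w`. -/
def exchangeForm (E : ℝ) (i j : Fin N) (w : (Fin N → ℝ) → ℝ≥0∞) (f : (Fin N → ℝ) → ℝ) : ℝ≥0∞ :=
  ∫⁻ η, w η * (∫⁻ α, sqDist (f η) (f (exchange i j α η)) ∂unitUniform) ∂uniformMeasure N E

/-- The configuration in which `i` receives `x` and `k` the rest of their total energy. -/
def assign (k i : Fin N) (x : ℝ) (η : Fin N → ℝ) : Fin N → ℝ :=
  fun l => if l = k then η k + η i - x else if l = i then x else η l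

lemma assign_eq_exchange (k i : Fin N) (α : ℝ) (η : Fin N → ℝ) :
    assign k i (α * (η k + η i)) η = exchange k i α η := by
  ext l; unfold assign exchange; split_ifs <;> ring

lemma measurable_assign (k i : Fin N) :
    Measurable fun p : (Fin N → ℝ) × ℝ => assign k i p.2 p.1 := by
  refine measurable_pi_lambda _ fun l => ?_
  unfold assign
  split_ifs <;> fun_prop

/-- The uniform law on `[0, r]` has density at most `u / r ≤ 2` with respect to the uniform law on
`[0, u]`. This allows a range of redistribution that does not depend on the pair's own energy. -/
lemma lintegral_unit_scale_le {G : ℝ → ℝ≥0∞} (hG : Measurable G) {r u : ℝ} (hr : 0 < r)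
    (hru : r ≤ u) (hur : u ≤ 2 * r) :
    ∫⁻ a, G (a * r) ∂unitUniform ≤ 2 * ∫⁻ α, G (α * u) ∂unitUniform := by
  have h : ENNReal.ofReal r * ∫⁻ a, G (a * r) ∂unitUniform ≤
      ENNReal.ofReal r * (2 * ∫⁻ α, G (α * u) ∂unitUniform) := by
    calc _ = ∫⁻ b in Icc 0 r, G b := (lintegral_Icc_eq_ofReal_mul G hG hr.le).symm
      _ ≤ ∫⁻ b in Icc 0 u, G b := lintegral_mono_set (Icc_subset_Icc_right hru)
      _ = ENNReal.ofReal u * ∫⁻ α, G (α * u) ∂unitUniform :=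
        lintegral_Icc_eq_ofReal_mul G hG (hr.le.trans hru)
      _ ≤ ENNReal.ofReal (2 * r) * ∫⁻ α, G (α * u) ∂unitUniform := by gcongr
      _ = _ := by
        rw [ENNReal.ofReal_mul (by norm_num), ENNReal.ofReal_ofNat]; ring
  exact (ENNReal.mul_le_mul_iff_right (by simpa using hr) ENNReal.ofReal_ne_top).1 h

lemma measurable_lintegral_sqDist {f : (Fin N → ℝ) → ℝ} (hf : Measurable f) (i j : Fin N) :
    Measurable fun η => ∫⁻ α, sqDist (f η) (f (exchange i j α η)) ∂unitUniform := by
  refine Measurable.lintegral_prod_right'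
    (f := fun p : (Fin N → ℝ) × ℝ => sqDist (f p.1) (f (exchange i j p.2 p.1))) ?_
  exact measurable_sqDist (hf.comp measurable_fst) (hf.comp (measurable_exchange i j))

/-- The exchange form is controlled by the squared distance to a random target configuration that
does not depend on the distribution of the energy of the pair. -/
lemma exchangeForm_le_of_target (hN : 3 ≤ N) {E : ℝ} {i j : Fin N} (hij : i ≠ j)
    {P : Type*} [MeasurableSpace P] {ν : Measure P} [IsProbabilityMeasure ν]
    {Q : (Fin N → ℝ) → P → (Fin N → ℝ)} (hQ : Measurable (Function.uncurry Q))
    (hQinv : ∀ η α, Q (exchange i j α η) = Q η) {w : (Fin N → ℝ) → ℝ≥0∞} (hw : Measurable w)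
    (hwinv : ∀ η α, w (exchange i j α η) = w η) {f : (Fin N → ℝ) → ℝ} (hf : Measurable f) :
    exchangeForm E i j w f ≤
      4 * ∫⁻ η, w η * (∫⁻ p, sqDist (f η) (f (Q η p)) ∂ν) ∂uniformMeasure N E := by
  set T : (Fin N → ℝ) → ℝ≥0∞ := fun η => ∫⁻ p, sqDist (f η) (f (Q η p)) ∂ν with hT
  have hTm : Measurable T := Measurable.lintegral_prod_right'
    (f := fun q : (Fin N → ℝ) × P => sqDist (f q.1) (f (Q q.1 q.2)))
    (measurable_sqDist (hf.comp measurable_fst) (hf.comp hQ))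
  -- Both configurations have the same random target, so the triangle inequality passes through it.
  -- By invariance the two resulting terms have equal integrals, whence `4 = 2 + 2`.
  have hd : ∀ η α, sqDist (f η) (f (exchange i j α η)) ≤ 2 * T η + 2 * T (exchange i j α η) := by
    intro η α
    have hm : ∀ c, Measurable fun p => sqDist c (f (Q η p)) := fun c =>
      measurable_sqDist measurable_const (hf.comp (hQ.comp measurable_prodMk_left))
    calc sqDist (f η) (f (exchange i j α η))
        = ∫⁻ p, sqDist (f η) (f (exchange i j α η)) ∂ν := by simp
      _ ≤ ∫⁻ p, (2 * sqDist (f η) (f (Q η p)) +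
            2 * sqDist (f (exchange i j α η)) (f (Q η p))) ∂ν := by
          refine lintegral_mono fun p => ?_
          rw [sqDist_comm (f (exchange i j α η)) (f (Q η p))]
          exact sqDist_le _ _ _
      _ = 2 * T η + 2 * T (exchange i j α η) := by
          rw [lintegral_add_left ((hm _).const_mul 2), lintegral_const_mul' _ _ (by simp),
            lintegral_const_mul' _ _ (by simp)]
          simp only [hT, hQinv]
  have hwT : Measurable fun η => w η * T η := hw.mul hTm
  calc exchangeForm E i j w f
      = ∫⁻ η, (∫⁻ α, w η * sqDist (f η) (f (exchange i j α η)) ∂unitUniform)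
          ∂uniformMeasure N E := by
        unfold exchangeForm
        congr 1; ext η
        rw [lintegral_const_mul]
        exact measurable_sqDist measurable_const
          (hf.comp ((measurable_exchange i j).comp measurable_prodMk_left))
    _ ≤ ∫⁻ η, (∫⁻ α, (2 * (w η * T η) +
          2 * (w (exchange i j α η) * T (exchange i j α η))) ∂unitUniform)
          ∂uniformMeasure N E := by
        refine lintegral_mono fun η => lintegral_mono fun α => ?_
        calc w η * sqDist (f η) (f (exchange i j α η))
            ≤ w η * (2 * T η + 2 * T (exchange i j α η)) := mul_le_mul' le_rfl (hd η α)
          _ = _ := by rw [hwinv]; ring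
    _ = ∫⁻ η, (2 * (w η * T η) +
          2 * (∫⁻ α, w (exchange i j α η) * T (exchange i j α η) ∂unitUniform))
          ∂uniformMeasure N E := by
        congr 1; ext η
        rw [lintegral_add_left measurable_const, lintegral_const, measure_univ, mul_one,
          lintegral_const_mul' _ _ (by simp)]
    _ = _ := by
        rw [lintegral_add_left (hwT.const_mul 2), lintegral_const_mul' _ _ (by simp),
          lintegral_const_mul' _ _ (by simp), lintegral_exchange hN hij hwT, ← add_mul]
        norm_num
        rfl

/-- For three particles, an exchange between `i` and `j` at the energy of `k` is controlled by
the exchanges at the energy of the pairs. -/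
lemma exchangeForm_three_body (hN : 3 ≤ N) {E : ℝ} {i j k : Fin N} (hij : i ≠ j) (hik : i ≠ k)
    (hjk : j ≠ k) {f : (Fin N → ℝ) → ℝ} (hf : Measurable f) :
    exchangeForm E i j (fun η => ENNReal.ofReal (η k)) f ≤
      exchangeForm E i j (fun η => ENNReal.ofReal (η i + η j)) f +
      (16 * exchangeForm E k i (fun η => ENNReal.ofReal (η k + η i)) f +
      64 * exchangeForm E k j (fun η => ENNReal.ofReal (η k + η j)) f) := by
  classical
  -- Off `B` the rate `η k` is already at most the pair energy; only `B`, where `k` is rich, needs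
  -- the detour.
  set B : Set (Fin N → ℝ) := {η | η i + η j < η k} with hB
  have hBm : MeasurableSet B := measurableSet_lt (by fun_prop) (by fun_prop)
  set w : (Fin N → ℝ) → ℝ≥0∞ := B.indicator fun η => ENNReal.ofReal (η k) with hw
  have hwm : Measurable w := Measurable.indicator (by fun_prop) hBm
  have hsplit : ∀ η : Fin N → ℝ, ENNReal.ofReal (η k) ≤ ENNReal.ofReal (η i + η j) + w η := by
    intro η
    by_cases h : η ∈ B
    · rw [hw, indicator_of_mem h]; exact le_add_self
    · have : η k ≤ η i + η j := not_lt.1 h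
      exact (ENNReal.ofReal_le_ofReal this).trans le_self_add
  have hVm := fun a b : Fin N => measurable_lintegral_sqDist hf a b
  have step1 : exchangeForm E i j (fun η => ENNReal.ofReal (η k)) f ≤
      exchangeForm E i j (fun η => ENNReal.ofReal (η i + η j)) f + exchangeForm E i j w f := by
    unfold exchangeForm
    have hwV : Measurable fun η => w η * ∫⁻ α, sqDist (f η) (f (exchange i j α η)) ∂unitUniform :=
      hwm.mul (hVm i j)
    rw [← lintegral_add_right _ hwV]
    refine lintegral_mono fun η => ?_
    rw [← add_mul]
    gcongr
    exact hsplit η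
  refine step1.trans ?_
  gcongr
  -- Half the energy of the three particles. `X` gives `i` the energy `a * r`, then `Y` gives `j`
  -- the energy `b * r`, and `k` keeps the rest. The outcome depends on `η i` and `η j` only through
  -- their sum. On `B` the energies redistributed in the two moves lie in `[r, 2 * r]`, as
  -- `lintegral_unit_scale_le` requires.
  set r : (Fin N → ℝ) → ℝ := fun η => (η i + η j + η k) / 2 with hr
  have hrm : Measurable r := by fun_prop
  set X : (Fin N → ℝ) → ℝ → (Fin N → ℝ) := fun η a => assign k i (a * r η) η with hX
  set Y : (Fin N → ℝ) → ℝ → (Fin N → ℝ) := fun η b => assign k j (b * r η) η with hY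
  have hXm : Measurable (Function.uncurry X) := by
    have : Measurable fun p : (Fin N → ℝ) × ℝ => (p.1, p.2 * r p.1) := by fun_prop
    exact (measurable_assign k i).comp this
  have hYm : Measurable (Function.uncurry Y) := by
    have : Measurable fun p : (Fin N → ℝ) × ℝ => (p.1, p.2 * r p.1) := by fun_prop
    exact (measurable_assign k j).comp this
  have hrX : ∀ η a, r (X η a) = r η := by
    intro η a; simp only [hr, hX, assign, hik, hjk, hij.symm, if_true, if_false]; ring
  set T1 : (Fin N → ℝ) → ℝ≥0∞ := fun η => ∫⁻ a, sqDist (f η) (f (X η a)) ∂unitUniform with hT1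
  set h : (Fin N → ℝ) → ℝ≥0∞ := fun η => ∫⁻ b, sqDist (f η) (f (Y η b)) ∂unitUniform with hh
  set T2 : (Fin N → ℝ) → ℝ≥0∞ := fun η => ∫⁻ a, h (X η a) ∂unitUniform with hT2
  set T : (Fin N → ℝ) → ℝ≥0∞ := fun η =>
    ∫⁻ a, (∫⁻ b, sqDist (f η) (f (Y (X η a) b)) ∂unitUniform) ∂unitUniform with hT
  have hTT : ∀ η, T η ≤ 2 * T1 η + 2 * T2 η := by
    intro η
    have e1 : Measurable fun a => sqDist (f η) (f (X η a)) :=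
      measurable_sqDist measurable_const (hf.comp (hXm.comp measurable_prodMk_left))
    calc T η ≤ ∫⁻ a, (2 * sqDist (f η) (f (X η a)) + 2 * h (X η a)) ∂unitUniform := by
          refine lintegral_mono fun a => ?_
          calc _ ≤ ∫⁻ b, (2 * sqDist (f η) (f (X η a)) +
                2 * sqDist (f (X η a)) (f (Y (X η a) b))) ∂unitUniform :=
                lintegral_mono fun b => sqDist_le _ _ _
            _ = _ := by
              rw [lintegral_add_left measurable_const, lintegral_const, measure_univ, mul_one,
                lintegral_const_mul' _ _ (by simp)]
      _ = _ := by
        rw [lintegral_add_left (e1.const_mul 2), lintegral_const_mul' _ _ (by simp),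
          lintegral_const_mul' _ _ (by simp)]
  have step2 : exchangeForm E i j w f ≤ 4 * ∫⁻ η, w η * T η ∂uniformMeasure N E := by
    have hYX : Measurable fun q : (Fin N → ℝ) × (ℝ × ℝ) => Y (X q.1 q.2.1) q.2.2 :=
      hYm.comp ((hXm.comp (measurable_fst.prodMk measurable_snd.fst)).prodMk measurable_snd.snd)
    have hinv : ∀ η α, (fun p : ℝ × ℝ => Y (X (exchange i j α η) p.1) p.2) =
        fun p => Y (X η p.1) p.2 := by
      intro η α
      have hrr : r (exchange i j α η) = r η := by
        simp only [hr]; rw [exchange_add hij, exchange_of_ne hik.symm hjk.symm]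
      ext p l
      simp only [hY]
      rw [hrX, hrX, hrr]
      simp only [hX, hrr]
      simp only [assign, exchange, hij.symm, hjk, hik.symm, hjk.symm, if_true, if_false]
      split_ifs <;> first | rfl | ring
    have hww : ∀ η α, w (exchange i j α η) = w η := by
      intro η α
      have h1 : exchange i j α η ∈ B ↔ η ∈ B := by
        simp only [hB, mem_ofPred_eq, exchange_add hij, exchange_of_ne hik.symm hjk.symm]
      by_cases h2 : η ∈ B
      · rw [hw, indicator_of_mem h2, indicator_of_mem (h1.2 h2),
          exchange_of_ne hik.symm hjk.symm]
      · rw [hw, indicator_of_notMem h2, indicator_of_notMem (mt h1.1 h2)]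
    refine (exchangeForm_le_of_target hN hij (ν := unitUniform.prod unitUniform)
      (Q := fun η p => Y (X η p.1) p.2) hYX hinv hwm hww hf).trans_eq ?_
    congr 2; ext η; congr 1
    rw [lintegral_prod]
    exact (measurable_sqDist measurable_const
      (hf.comp (hYX.comp measurable_prodMk_left))).aemeasurable
  -- The first move: `η k ≤ η k + η i`, and the change of scale costs `2`.
  have hb1 : ∀ η ∈ stateSpace N E, w η * T1 η ≤ 2 * (ENNReal.ofReal (η k + η i) *
      ∫⁻ α, sqDist (f η) (f (exchange k i α η)) ∂unitUniform) := by
    intro η hη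
    by_cases hmem : η ∈ B
    · have hlt : η i + η j < η k := hmem
      have h1 := hη.1 i
      have h2 := hη.1 j
      rw [hw, indicator_of_mem hmem]
      have := lintegral_unit_scale_le (G := fun x => sqDist (f η) (f (assign k i x η)))
        (measurable_sqDist measurable_const (hf.comp ((measurable_assign k i).comp
          measurable_prodMk_left))) (r := r η) (u := η k + η i) (by simp only [hr]; linarith)
          (by simp only [hr]; linarith) (by simp only [hr]; linarith)
      simp only [assign_eq_exchange] at this
      calc _ ≤ ENNReal.ofReal (η k + η i) * (2 * ∫⁻ α, sqDist (f η) (f (exchange k i α η))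
            ∂unitUniform) := by gcongr; linarith
        _ = _ := by ring
    · rw [hw, indicator_of_notMem hmem]; simp
  set g : (Fin N → ℝ) → ℝ≥0∞ := fun ζ => ENNReal.ofReal (ζ k + ζ j) *
      ∫⁻ α, sqDist (f ζ) (f (exchange k j α ζ)) ∂unitUniform with hg
  have hgm : Measurable g := Measurable.mul (by fun_prop) (hVm k j)
  -- The second move starts from `X η a`, whose pair energy at `(k, j)` is at least `r ≥ η k / 2`.
  -- This costs `2`, and the changes of scale in `b` and in `a` cost `2` each.
  have hb2 : ∀ η ∈ stateSpace N E, w η * T2 η ≤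
      8 * ∫⁻ α, g (exchange k i α η) ∂unitUniform := by
    intro η hη
    by_cases hmem : η ∈ B
    · have hlt : η i + η j < η k := hmem
      have h1 := hη.1 i
      have h2 := hη.1 j
      have hrpos : 0 < r η := by simp only [hr]; linarith
      rw [hw, indicator_of_mem hmem]
      have hpt : ∀ a ∈ Icc (0 : ℝ) 1, ENNReal.ofReal (η k) * h (X η a) ≤ 4 * g (X η a) := by
        intro a ha
        have hXi : X η a i = a * r η := by simp [hX, assign, hik]
        have hXkj : X η a k + X η a j = 2 * r η - a * r η := by
          simp only [hX, hr, assign, hjk, hij.symm, if_true, if_false]; ring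
        have h3 : a * r η ≤ r η := by nlinarith [ha.2]
        have h4 : 0 ≤ a * r η := mul_nonneg ha.1 hrpos.le
        have hk2 : η k ≤ 2 * r η := by simp only [hr]; linarith
        have := lintegral_unit_scale_le (G := fun x => sqDist (f (X η a)) (f (assign k j x (X η a))))
          (measurable_sqDist measurable_const (hf.comp ((measurable_assign k j).comp
            measurable_prodMk_left))) (r := r (X η a)) (u := X η a k + X η a j)
            (by rw [hrX]; exact hrpos) (by rw [hrX, hXkj]; linarith) (by rw [hrX, hXkj]; linarith)
        simp only [assign_eq_exchange] at this
        calc ENNReal.ofReal (η k) * h (X η a)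
            ≤ ENNReal.ofReal (2 * (X η a k + X η a j)) *
              (2 * ∫⁻ α, sqDist (f (X η a)) (f (exchange k j α (X η a))) ∂unitUniform) := by
              gcongr
              rw [hXkj]; linarith
          _ = 4 * g (X η a) := by
              rw [ENNReal.ofReal_mul (by norm_num), ENNReal.ofReal_ofNat, hg]; ring
      have hgX : Measurable fun x => g (assign k i x η) :=
        hgm.comp ((measurable_assign k i).comp measurable_prodMk_left)
      have := lintegral_unit_scale_le (G := fun x => g (assign k i x η)) hgX (r := r η)
          (u := η k + η i) hrpos (by simp only [hr]; linarith) (by simp only [hr]; linarith)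
      simp only [assign_eq_exchange] at this
      calc ENNReal.ofReal (η k) * T2 η = ∫⁻ a, ENNReal.ofReal (η k) * h (X η a) ∂unitUniform := by
            rw [lintegral_const_mul' _ _ ENNReal.ofReal_ne_top]
        _ ≤ ∫⁻ a, 4 * g (X η a) ∂unitUniform := setLIntegral_mono' measurableSet_Icc hpt
        _ = 4 * ∫⁻ a, g (X η a) ∂unitUniform := lintegral_const_mul' _ _ (by simp)
        _ ≤ 4 * (2 * ∫⁻ α, g (exchange k i α η) ∂unitUniform) := by gcongr
        _ = _ := by rw [← mul_assoc]; norm_num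
    · rw [hw, indicator_of_notMem hmem]; simp
  refine step2.trans ?_
  calc 4 * ∫⁻ η, w η * T η ∂uniformMeasure N E
      ≤ 4 * ∫⁻ η, (4 * (ENNReal.ofReal (η k + η i) *
          ∫⁻ α, sqDist (f η) (f (exchange k i α η)) ∂unitUniform) +
          16 * ∫⁻ α, g (exchange k i α η) ∂unitUniform) ∂uniformMeasure N E := by
        gcongr 4 * ?_
        refine lintegral_mono_ae ?_
        filter_upwards [ae_mem_stateSpace N E] with η hη
        calc w η * T η ≤ w η * (2 * T1 η + 2 * T2 η) := by gcongr; exact hTT η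
          _ = 2 * (w η * T1 η) + 2 * (w η * T2 η) := by ring
          _ ≤ 2 * (2 * (ENNReal.ofReal (η k + η i) *
              ∫⁻ α, sqDist (f η) (f (exchange k i α η)) ∂unitUniform)) +
              2 * (8 * ∫⁻ α, g (exchange k i α η) ∂unitUniform) := by
              exact add_le_add (mul_le_mul' le_rfl (hb1 η hη)) (mul_le_mul' le_rfl (hb2 η hη))
          _ = _ := by ring
    _ = 4 * (4 * exchangeForm E k i (fun η => ENNReal.ofReal (η k + η i)) f +
          16 * exchangeForm E k j (fun η => ENNReal.ofReal (η k + η j)) f) := by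
        rw [lintegral_add_left, lintegral_const_mul' _ _ (by simp),
          -- Invariance removes the first move from the second term, leaving a plain exchange form
          -- of `(k, j)`.
          lintegral_const_mul' _ _ (by simp), lintegral_exchange hN hik.symm hgm]
        · rfl
        · exact (Measurable.mul (by fun_prop) (hVm k i)).const_mul 4
    _ = _ := by rw [mul_add, ← mul_assoc, ← mul_assoc]; norm_num

lemma exchangeForm_mono {E : ℝ} {i j : Fin N} {v w : (Fin N → ℝ) → ℝ≥0∞} {f : (Fin N → ℝ) → ℝ}
    (h : ∀ η ∈ stateSpace N E, v η ≤ w η) : exchangeForm E i j v f ≤ exchangeForm E i j w f := by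
  refine lintegral_mono_ae ?_
  filter_upwards [ae_mem_stateSpace N E] with η hη
  exact mul_le_mul' (h η hη) le_rfl

/-- Comparison of the exchanges at constant rate with those at the energy of the pair. -/
lemma sum_exchangeForm_one_le (hN : 3 ≤ N) {f : (Fin N → ℝ) → ℝ} (hf : Measurable f) :
    ∑ i : Fin N, ∑ j : Fin N, (if i = j then 0 else exchangeForm 1 i j (fun _ => 1) f) ≤
      81 * ∑ i : Fin N, ∑ j : Fin N, (if i = j then 0 else
        exchangeForm 1 i j (fun η => ENNReal.ofReal (η i + η j)) f) := by
  set a : Fin N → Fin N → ℝ≥0∞ := fun i j => if i = j then 0 else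
    exchangeForm 1 i j (fun η => ENNReal.ofReal (η i + η j)) f with ha
  set b : Fin N → Fin N → ℝ≥0∞ := fun i j => if i = j then 0 else
    exchangeForm 1 i j (fun _ => 1) f with hb
  have hk : ∀ i j k, i ≠ j → exchangeForm 1 i j (fun η => ENNReal.ofReal (η k)) f ≤
      a i j + (16 * a k i + 64 * a k j) := by
    intro i j k hij
    by_cases hi : i = k
    · subst hi
      refine le_trans ?_ le_self_add
      simp only [ha, hij, if_false]
      exact exchangeForm_mono fun η hη => ENNReal.ofReal_le_ofReal (by linarith [hη.1 j])
    by_cases hj : j = k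
    · subst hj
      refine le_trans ?_ le_self_add
      simp only [ha, hij, if_false]
      exact exchangeForm_mono fun η hη => ENNReal.ofReal_le_ofReal (by linarith [hη.1 i])
    · simp only [ha, hij, Ne.symm hi, Ne.symm hj, if_false]
      exact exchangeForm_three_body hN hij hi hj hf
  -- The constant rate `N` is `∑ k, η k` on the simplex. After summation over `i` and `j`, each of
  -- the three terms becomes `N` times the same double sum, so the constant is `81 = 1 + 16 + 64`.
  have hsum : ∀ i j, (N : ℝ≥0∞) * b i j ≤ ∑ k, (a i j + (16 * a k i + 64 * a k j)) := by
    intro i j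
    by_cases hij : i = j
    · simp [hb, hij]
    · refine le_trans (le_of_eq ?_) (Finset.sum_le_sum fun k _ => hk i j k hij)
      simp only [hb, hij, if_false, exchangeForm]
      rw [← lintegral_finsetSum, ← lintegral_const_mul' _ _ (by simp)]
      · refine lintegral_congr_ae ?_
        filter_upwards [ae_mem_stateSpace N 1] with η hη
        rw [← Finset.sum_mul, ← ENNReal.ofReal_sum_of_nonneg fun k _ => hη.1 k, hη.2]
        simp
      · exact fun k _ => Measurable.mul (by fun_prop) (measurable_lintegral_sqDist hf i j)
  have hN0 : (N : ℝ≥0∞) ≠ 0 := by simp; omega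
  refine (ENNReal.mul_le_mul_iff_right hN0 (by simp)).1 ?_
  have h16 : ∑ i : Fin N, ∑ _j : Fin N, ∑ k, a k i = N * ∑ i, ∑ j, a i j := by
    have : ∀ i, ∑ j : Fin N, ∑ k, a k i = N * ∑ k, a k i := fun i => by simp
    rw [Finset.sum_congr rfl fun i _ => this i, ← Finset.mul_sum, Finset.sum_comm]
  have h64 : ∑ _i : Fin N, ∑ j, ∑ k, a k j = N * ∑ i, ∑ j, a i j := by
    rw [Finset.sum_const, Finset.card_univ, Fintype.card_fin, nsmul_eq_mul, Finset.sum_comm]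
  calc (N : ℝ≥0∞) * ∑ i, ∑ j, b i j = ∑ i, ∑ j, N * b i j := by simp_rw [Finset.mul_sum]
    _ ≤ ∑ i, ∑ j, ∑ k, (a i j + (16 * a k i + 64 * a k j)) :=
      Finset.sum_le_sum fun i _ => Finset.sum_le_sum fun j _ => hsum i j
    _ = N * ∑ i, ∑ j, a i j + (16 * ∑ i : Fin N, ∑ _j : Fin N, ∑ k, a k i +
        64 * ∑ _i : Fin N, ∑ j, ∑ k, a k j) := by
      simp only [Finset.sum_add_distrib, Finset.mul_sum]
      simp [Finset.mul_sum]
    _ = _ := by rw [h16, h64]; ring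

/-! ### Pair averages and the averaged exchange operator on `L²` -/

lemma pairAverage_eq (i j : Fin N) (f : (Fin N → ℝ) → ℝ) (η : Fin N → ℝ) :
    pairAverage i j f η = ∫ α, f (exchange i j α η) ∂unitUniform := by
  rw [pairAverage, intervalIntegral.integral_of_le zero_le_one, ← integral_Icc_eq_integral_Ioc]

lemma pairAverage_comm {i j : Fin N} (hij : i ≠ j) (f : (Fin N → ℝ) → ℝ) :
    pairAverage i j f = pairAverage j i f := by
  ext η
  unfold pairAverage
  have := intervalIntegral.integral_comp_sub_left (a := 0) (b := 1)
    (fun α => f (exchange i j α η)) 1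
  rw [sub_self, sub_zero] at this
  rw [← this]
  congr 1; ext α; congr 1; ext k
  unfold exchange
  by_cases h1 : k = i
  · subst h1; simp only [if_true, if_false, hij]; ring
  · by_cases h2 : k = j
    · subst h2; simp only [if_true, if_false, h1]; ring
    · simp only [h1, h2, if_false]

lemma measurePreserving_exchange (hN : 3 ≤ N) {E : ℝ} (hE : 0 < E) {i j : Fin N} (hij : i ≠ j) :
    MeasurePreserving (fun p : (Fin N → ℝ) × ℝ => exchange i j p.2 p.1)
      ((uniformMeasure N E).prod unitUniform) (uniformMeasure N E) := by
  have := isProbabilityMeasure_uniformMeasure (N := N) (by omega) hE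
  refine ⟨measurable_exchange i j, Measure.ext_of_lintegral _ fun F hF => ?_⟩
  rw [lintegral_map hF (measurable_exchange i j), lintegral_prod]
  · exact lintegral_exchange hN hij hF
  · exact (hF.comp (measurable_exchange i j)).aemeasurable

/-- The Dirichlet form of the exchange between `i` and `j` at rate `φ (η i + η j)`. -/
lemma exchangeForm_eq_integral (hN : 3 ≤ N) {E : ℝ} (hE : 0 < E) {i j : Fin N} (hij : i ≠ j)
    {φ : ℝ → ℝ} (hφ : Measurable φ) {M : ℝ} (hφ0 : ∀ s ∈ Icc 0 (N * E), 0 ≤ φ s)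
    (hφM : ∀ s ∈ Icc 0 (N * E), φ s ≤ M) {f : (Fin N → ℝ) → ℝ} (hf : Measurable f)
    (hf2 : MemLp f 2 (uniformMeasure N E)) :
    Integrable (fun η => f η * (φ (η i + η j) * (f η - pairAverage i j f η)))
      (uniformMeasure N E) ∧
    exchangeForm E i j (fun η => ENNReal.ofReal (φ (η i + η j))) f = ENNReal.ofReal
      (2 * ∫ η, f η * (φ (η i + η j) * (f η - pairAverage i j f η)) ∂uniformMeasure N E) ∧
    0 ≤ ∫ η, f η * (φ (η i + η j) * (f η - pairAverage i j f η)) ∂uniformMeasure N E := by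
  have := isProbabilityMeasure_uniformMeasure (N := N) (by omega) hE
  set μ := uniformMeasure N E with hμ
  have hmp := measurePreserving_exchange hN hE hij
  rw [← hμ] at hmp
  have hfst : MeasurePreserving (Prod.fst : (Fin N → ℝ) × ℝ → _) (μ.prod unitUniform) μ :=
    measurePreserving_fst
  set w : (Fin N → ℝ) → ℝ := fun η => φ (η i + η j) with hw
  have hwm : Measurable w := hφ.comp (by fun_prop)
  have hwx : ∀ η α, w (exchange i j α η) = w η := fun η α => by
    simp only [hw, exchange_add hij]
  have hwS : ∀ᵐ η ∂μ, 0 ≤ w η ∧ w η ≤ M := by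
    filter_upwards [ae_mem_stateSpace N E] with η hη
    have : η i + η j ∈ Icc 0 (N * E) :=
      ⟨add_nonneg (hη.1 i) (hη.1 j), add_le_of_mem_stateSpace hη hij⟩
    exact ⟨hφ0 _ this, hφM _ this⟩
  have hwb : ∀ᵐ η ∂μ, ‖w η‖ ≤ M := by
    filter_upwards [hwS] with η hη
    rw [Real.norm_eq_abs, abs_of_nonneg hη.1]; exact hη.2
  have hwb' : ∀ᵐ p ∂μ.prod unitUniform, ‖w p.1‖ ≤ M := hfst.quasiMeasurePreserving.ae hwb
  have hF1 : MemLp (fun p : (Fin N → ℝ) × ℝ => f p.1) 2 (μ.prod unitUniform) :=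
    hf2.comp_measurePreserving hfst
  have hF2 : MemLp (fun p : (Fin N → ℝ) × ℝ => f (exchange i j p.2 p.1)) 2 (μ.prod unitUniform) :=
    hf2.comp_measurePreserving hmp
  have hwm' : AEStronglyMeasurable (fun p : (Fin N → ℝ) × ℝ => w p.1) (μ.prod unitUniform) :=
    (hwm.comp measurable_fst).aestronglyMeasurable
  have i11 := (hF1.integrable_mul hF1).bdd_mul hwm' hwb'
  have i12 := (hF1.integrable_mul hF2).bdd_mul hwm' hwb'
  have i22 := (hF2.integrable_mul hF2).bdd_mul hwm' hwb'
  have iff' := (hf2.integrable_mul hf2).bdd_mul hwm.aestronglyMeasurable hwb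
  simp only [Pi.mul_apply] at i11 i12 i22 iff'
  have hslice : ∀ η, ∫ α, w η * (f η * f (exchange i j α η)) ∂unitUniform =
      w η * (f η * pairAverage i j f η) := fun η => by
    rw [integral_const_mul, integral_const_mul, pairAverage_eq]
  have hPint : Integrable (fun η => w η * (f η * pairAverage i j f η)) μ :=
    i12.integral_prod_left.congr (Filter.Eventually.of_forall hslice)
  have e12 : ∫ p, w p.1 * (f p.1 * f (exchange i j p.2 p.1)) ∂μ.prod unitUniform =
      ∫ η, w η * (f η * pairAverage i j f η) ∂μ := by
    rw [integral_prod _ i12]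
    exact integral_congr_ae (Filter.Eventually.of_forall hslice)
  have e11 : ∫ p, w p.1 * (f p.1 * f p.1) ∂μ.prod unitUniform = ∫ η, w η * (f η * f η) ∂μ := by
    rw [integral_prod _ i11]
    simp
  have e22 : ∫ p, w p.1 * (f (exchange i j p.2 p.1) * f (exchange i j p.2 p.1)) ∂μ.prod unitUniform
      = ∫ η, w η * (f η * f η) ∂μ := by
    conv_rhs => rw [← hmp.map_eq]
    have hm : Measurable fun η => w η * (f η * f η) := hwm.mul (hf.mul hf)
    rw [integral_map hmp.measurable.aemeasurable hm.aestronglyMeasurable]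
    simp only [hwx]
  have heq : ∀ η, f η * (w η * (f η - pairAverage i j f η)) =
      w η * (f η * f η) - w η * (f η * pairAverage i j f η) := fun η => by ring
  have hint : Integrable (fun η => f η * (w η * (f η - pairAverage i j f η))) μ := by
    simp_rw [heq]; exact iff'.sub hPint
  -- Expanding the square, the two diagonal terms coincide by invariance of the measure and of `w`,
  -- and the cross term is the pair average.
  have hval : ∫ p, w p.1 * (f p.1 - f (exchange i j p.2 p.1)) ^ 2 ∂μ.prod unitUniform =
      2 * ∫ η, f η * (w η * (f η - pairAverage i j f η)) ∂μ := by
    simp_rw [heq]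
    rw [integral_sub iff' hPint]
    have : ∀ p : (Fin N → ℝ) × ℝ, w p.1 * (f p.1 - f (exchange i j p.2 p.1)) ^ 2 =
        w p.1 * (f p.1 * f p.1) + w p.1 * (f (exchange i j p.2 p.1) * f (exchange i j p.2 p.1))
        - 2 * (w p.1 * (f p.1 * f (exchange i j p.2 p.1))) := fun p => by ring
    simp_rw [this]
    have isum : Integrable (fun p : (Fin N → ℝ) × ℝ => w p.1 * (f p.1 * f p.1) +
      w p.1 * (f (exchange i j p.2 p.1) * f (exchange i j p.2 p.1))) (μ.prod unitUniform) :=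
      i11.add i22
    rw [integral_sub isum (i12.const_mul 2)]
    rw [integral_add i11 i22, integral_const_mul, e11, e22, e12]
    ring
  have hsqi : Integrable (fun p : (Fin N → ℝ) × ℝ =>
      w p.1 * (f p.1 - f (exchange i j p.2 p.1)) ^ 2) (μ.prod unitUniform) := by
    have := ((hF1.sub hF2).integrable_mul (hF1.sub hF2)).bdd_mul hwm' hwb'
    refine this.congr (Filter.Eventually.of_forall fun p => ?_)
    simp only [Pi.mul_apply, Pi.sub_apply, sq]
  have hnn : ∀ᵐ p ∂μ.prod unitUniform, 0 ≤ w p.1 * (f p.1 - f (exchange i j p.2 p.1)) ^ 2 := by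
    have : ∀ᵐ p ∂μ.prod unitUniform, 0 ≤ w p.1 ∧ w p.1 ≤ M := hfst.quasiMeasurePreserving.ae hwS
    filter_upwards [this] with p hp
    exact mul_nonneg hp.1 (sq_nonneg _)
  refine ⟨hint, ?_, ?_⟩
  · rw [← hval, ofReal_integral_eq_lintegral_ofReal hsqi hnn, lintegral_prod]
    · unfold exchangeForm
      refine lintegral_congr_ae ?_
      filter_upwards [hwS] with η hη
      rw [← lintegral_const_mul' _ _ ENNReal.ofReal_ne_top]
      congr 1; ext α
      rw [sqDist, ENNReal.ofReal_mul hη.1]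
    · exact hsqi.aestronglyMeasurable.aemeasurable.ennreal_ofReal
  · have := integral_nonneg_of_ae hnn
    rw [hval] at this
    linarith

lemma integrable_of_continuous (hN : N ≠ 0) {E : ℝ} (hE : 0 < E) {g : (Fin N → ℝ) → ℝ}
    (hg : Continuous g) : Integrable g (uniformMeasure N E) := by
  have := isProbabilityMeasure_uniformMeasure hN hE
  obtain ⟨C, hC⟩ := (isCompact_stateSpace N E).exists_bound_of_continuousOn hg.continuousOn
  refine Integrable.of_bound hg.aestronglyMeasurable C ?_
  filter_upwards [ae_mem_stateSpace N E] with η hη using hC η hη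

lemma memLp_of_continuous (hN : N ≠ 0) {E : ℝ} (hE : 0 < E) {g : (Fin N → ℝ) → ℝ}
    (hg : Continuous g) : MemLp g 2 (uniformMeasure N E) := by
  have := isProbabilityMeasure_uniformMeasure hN hE
  obtain ⟨C, hC⟩ := (isCompact_stateSpace N E).exists_bound_of_continuousOn hg.continuousOn
  refine MemLp.of_bound hg.aestronglyMeasurable C ?_
  filter_upwards [ae_mem_stateSpace N E] with η hη using hC η hη

lemma continuous_pairAverage (i j : Fin N) {g : (Fin N → ℝ) → ℝ} (hg : Continuous g) :
    Continuous (pairAverage i j g) :=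
  intervalIntegral.continuous_parametric_intervalIntegral_of_continuous'
    (f := fun η α => g (exchange i j α η)) (hg.comp (continuous_exchange i j)) 0 1

lemma pairAverage_exchange {i j : Fin N} (hij : i ≠ j) (g : (Fin N → ℝ) → ℝ) (α : ℝ)
    (η : Fin N → ℝ) : pairAverage i j g (exchange i j α η) = pairAverage i j g η := by
  simp only [pairAverage, exchange_exchange hij]

/-- `pairAverage i j h` is constant along exchanges of `i` and `j`, so averaging the integrand over
such an exchange only averages `g`. Hence `pairAverage i j` acts as a symmetric projection. -/
lemma integral_mul_pairAverage (hN : 3 ≤ N) {E : ℝ} (hE : 0 < E) {i j : Fin N} (hij : i ≠ j)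
    {g h : (Fin N → ℝ) → ℝ} (hg : Continuous g) (hh : Continuous h) :
    ∫ η, g η * pairAverage i j h η ∂uniformMeasure N E =
      ∫ η, pairAverage i j g η * pairAverage i j h η ∂uniformMeasure N E := by
  have := isProbabilityMeasure_uniformMeasure (N := N) (by omega) hE
  have hmp := measurePreserving_exchange hN hE hij
  have hc : Continuous fun η => g η * pairAverage i j h η := hg.mul (continuous_pairAverage i j hh)
  have hi : Integrable (fun p : (Fin N → ℝ) × ℝ => g (exchange i j p.2 p.1) *
      pairAverage i j h (exchange i j p.2 p.1)) ((uniformMeasure N E).prod unitUniform) :=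
    hmp.integrable_comp_of_integrable (integrable_of_continuous (by omega) hE hc)
  conv_lhs => rw [← hmp.map_eq]
  rw [integral_map hmp.measurable.aemeasurable hc.aestronglyMeasurable, integral_prod _ hi]
  congr 1; ext η
  simp only [pairAverage_exchange hij]
  rw [integral_mul_const, ← pairAverage_eq]

lemma integral_pairAverage_mul (hN : 3 ≤ N) {E : ℝ} (hE : 0 < E) {i j : Fin N} (hij : i ≠ j)
    {g h : (Fin N → ℝ) → ℝ} (hg : Continuous g) (hh : Continuous h) :
    ∫ η, pairAverage i j g η * h η ∂uniformMeasure N E =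
      ∫ η, g η * pairAverage i j h η ∂uniformMeasure N E := by
  rw [integral_mul_pairAverage hN hE hij hg hh]
  simp_rw [mul_comm (pairAverage i j g _)]
  exact integral_mul_pairAverage hN hE hij hh hg

/-- The mean over the outcome of an exchange between a uniformly chosen pair of particles. -/
def exchangeAverage (g : (Fin N → ℝ) → ℝ) (η : Fin N → ℝ) : ℝ :=
  ((N : ℝ) * (N - 1))⁻¹ * ∑ p ∈ (Finset.univ : Finset (Fin N)).offDiag, pairAverage p.1 p.2 g η

lemma continuous_exchangeAverage {g : (Fin N → ℝ) → ℝ} (hg : Continuous g) :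
    Continuous (exchangeAverage g) :=
  continuous_const.mul (continuous_finsetSum _ fun p _ => continuous_pairAverage p.1 p.2 hg)

lemma integral_mul_exchangeAverage (hN : 3 ≤ N) {E : ℝ} (hE : 0 < E)
    {g h : (Fin N → ℝ) → ℝ} (hg : Continuous g) (hh : Continuous h) :
    ∫ η, g η * exchangeAverage h η ∂uniformMeasure N E = ((N : ℝ) * (N - 1))⁻¹ *
      ∑ p ∈ (Finset.univ : Finset (Fin N)).offDiag,
        ∫ η, g η * pairAverage p.1 p.2 h η ∂uniformMeasure N E := by
  rw [← integral_finsetSum, ← integral_const_mul]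
  · congr 1; ext η
    rw [exchangeAverage, ← Finset.mul_sum]; ring
  · exact fun p _ => integrable_of_continuous (by omega) hE
      (hg.mul (continuous_pairAverage p.1 p.2 hh))

lemma integral_exchangeAverage_mul (hN : 3 ≤ N) {E : ℝ} (hE : 0 < E)
    {g h : (Fin N → ℝ) → ℝ} (hg : Continuous g) (hh : Continuous h) :
    ∫ η, exchangeAverage g η * h η ∂uniformMeasure N E =
      ∫ η, g η * exchangeAverage h η ∂uniformMeasure N E := by
  simp_rw [mul_comm (exchangeAverage g _)]
  rw [integral_mul_exchangeAverage hN hE hh hg, integral_mul_exchangeAverage hN hE hg hh]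
  congr 1
  refine Finset.sum_congr rfl fun p hp => ?_
  rw [← integral_pairAverage_mul hN hE (Finset.mem_offDiag.1 hp).2.2 hg hh]
  simp_rw [mul_comm (h _)]

lemma card_offDiag_fin (N : ℕ) :
    (((Finset.univ : Finset (Fin N)).offDiag.card : ℕ) : ℝ) = (N : ℝ) * (N - 1) := by
  rw [Finset.offDiag_card, Finset.card_univ, Fintype.card_fin, Nat.cast_sub (Nat.le_mul_self N)]
  push_cast; ring

lemma exchangeAverage_const (hN : 3 ≤ N) (c : ℝ) (η : Fin N → ℝ) :
    exchangeAverage (fun _ => c) η = c := by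
  have : (3 : ℝ) ≤ N := by exact_mod_cast hN
  have h0 : (N : ℝ) * (N - 1) ≠ 0 := by nlinarith
  simp only [exchangeAverage, pairAverage, intervalIntegral.integral_const, sub_zero, one_smul,
    Finset.sum_const, nsmul_eq_mul, card_offDiag_fin]
  rw [← mul_assoc, inv_mul_cancel₀ h0, one_mul]

lemma integral_exchangeAverage (hN : 3 ≤ N) {E : ℝ} (hE : 0 < E)
    {g : (Fin N → ℝ) → ℝ} (hg : Continuous g) :
    ∫ η, exchangeAverage g η ∂uniformMeasure N E = ∫ η, g η ∂uniformMeasure N E := by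
  have := integral_exchangeAverage_mul hN hE hg (continuous_const (y := (1 : ℝ)))
  simpa only [exchangeAverage_const hN, mul_one] using this

/-! ### Contraction by coupling and the gap at constant rate -/

/-- Lipschitz continuity on the state space for the Euclidean distance, with squared constant `L`. -/
def SqLipschitz (E L : ℝ) (g : (Fin N → ℝ) → ℝ) : Prop :=
  ∀ η ∈ stateSpace N E, ∀ ξ ∈ stateSpace N E, (g η - g ξ) ^ 2 ≤ L * ∑ k, (η k - ξ k) ^ 2

lemma sq_intervalIntegral_le {u : ℝ → ℝ} (hu : Continuous u) :
    (∫ α in (0 : ℝ)..1, u α) ^ 2 ≤ ∫ α in (0 : ℝ)..1, u α ^ 2 := by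
  set c := ∫ α in (0 : ℝ)..1, u α with hc
  have h : 0 ≤ ∫ α in (0 : ℝ)..1, (u α - c) ^ 2 :=
    intervalIntegral.integral_nonneg zero_le_one fun α _ => sq_nonneg _
  have e : ∀ α, (u α - c) ^ 2 = u α ^ 2 - (2 * c * u α - c ^ 2) := fun α => by ring
  simp_rw [e] at h
  rw [intervalIntegral.integral_sub, intervalIntegral.integral_sub,
    intervalIntegral.integral_const_mul, intervalIntegral.integral_const, ← hc] at h
  · simp at h; linarith
  all_goals exact Continuous.intervalIntegrable (by fun_prop) _ _

/-- Both configurations are exchanged with the same fraction `α`, which leaves the pair with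
differences `(1 - α) * (d i + d j)` and `α * (d i + d j)`, where `d = η - ξ`. Jensen's inequality
moves the square inside, and `2 / 3` is the integral of `(1 - α) ^ 2 + α ^ 2`. -/
lemma sq_pairAverage_sub_le {E L : ℝ} {g : (Fin N → ℝ) → ℝ} (hg : Continuous g)
    (hL : SqLipschitz E L g) {i j : Fin N} (hij : i ≠ j) {η ξ : Fin N → ℝ}
    (hη : η ∈ stateSpace N E) (hξ : ξ ∈ stateSpace N E) :
    (pairAverage i j g η - pairAverage i j g ξ) ^ 2 ≤ L * (∑ k, (η k - ξ k) ^ 2 -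
      ((η i - ξ i) ^ 2 + (η j - ξ j) ^ 2) + 2 / 3 * ((η i - ξ i) + (η j - ξ j)) ^ 2) := by
  have hc : ∀ ζ : Fin N → ℝ, Continuous fun α => g (exchange i j α ζ) := fun ζ =>
    hg.comp ((continuous_exchange i j).comp (continuous_const.prodMk continuous_id))
  set D := ∑ k, (η k - ξ k) ^ 2 - ((η i - ξ i) ^ 2 + (η j - ξ j) ^ 2) with hD
  set q := ((η i - ξ i) + (η j - ξ j)) ^ 2 with hq
  have hpt : ∀ α ∈ Icc (0 : ℝ) 1, (g (exchange i j α η) - g (exchange i j α ξ)) ^ 2 ≤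
      L * (D + ((1 - α) ^ 2 + α ^ 2) * q) := by
    intro α hα
    refine (hL _ (exchange_mem hij hα hη) _ (exchange_mem hij hα hξ)).trans_eq ?_
    congr 1
    rw [hD, sum_eq_add_add hij, sum_eq_add_add hij fun k => (η k - ξ k) ^ 2]
    rw [exchange_left, exchange_left, exchange_right hij, exchange_right hij]
    have : ∑ k ∈ (Finset.univ.erase i).erase j, (exchange i j α η k - exchange i j α ξ k) ^ 2 =
        ∑ k ∈ (Finset.univ.erase i).erase j, (η k - ξ k) ^ 2 := by
      refine Finset.sum_congr rfl fun k hk => ?_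
      have h1 : k ≠ i := by simp_all
      have h2 : k ≠ j := by simp_all
      rw [exchange_of_ne h1 h2, exchange_of_ne h1 h2]
    rw [this, hq]
    ring
  have hval : ∫ α in (0 : ℝ)..1, L * (D + ((1 - α) ^ 2 + α ^ 2) * q) = L * (D + 2 / 3 * q) := by
    have : ∀ α : ℝ, L * (D + ((1 - α) ^ 2 + α ^ 2) * q) =
        L * (D + q) + (L * q * 2 * α ^ 2 - L * q * 2 * α ^ 1) := fun α => by ring
    simp_rw [this]
    rw [intervalIntegral.integral_add, intervalIntegral.integral_sub,
      intervalIntegral.integral_const_mul, intervalIntegral.integral_const_mul,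
      intervalIntegral.integral_const_mul, intervalIntegral.integral_const,
      integral_pow, integral_pow]
    · norm_num; ring
    all_goals exact Continuous.intervalIntegrable (by fun_prop) _ _
  rw [← hval]
  unfold pairAverage
  rw [← intervalIntegral.integral_sub ((hc η).intervalIntegrable _ _)
    ((hc ξ).intervalIntegrable _ _)]
  refine (sq_intervalIntegral_le ((hc η).sub (hc ξ))).trans ?_
  exact intervalIntegral.integral_mono_on zero_le_one
    ((((hc η).sub (hc ξ)).pow 2).intervalIntegrable _ _)
    (Continuous.intervalIntegrable (by fun_prop) _ _) hpt

lemma sum_offDiag_eq (F : Fin N → Fin N → ℝ) :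
    ∑ p ∈ (Finset.univ : Finset (Fin N)).offDiag, F p.1 p.2 = ∑ i, ∑ j, F i j - ∑ i, F i i := by
  have h := Finset.sum_product (Finset.univ : Finset (Fin N)) Finset.univ fun p => F p.1 p.2
  rw [← Finset.diag_union_offDiag, Finset.sum_union (Finset.disjoint_diag_offDiag _),
    Finset.sum_diag] at h
  linarith

/-- The contraction rate of the coupling of two exchange processes with the same fractions. -/
def contractionRate (N : ℕ) : ℝ := 1 - 2 / 3 * (N + 1) * ((N : ℝ) * (N - 1))⁻¹

/-- Averages the coupling bound over all pairs. The differences sum to zero, since both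
configurations have the same total, so the cross terms `d i * d j` over `i ≠ j` sum to `-∑ k, d k ^
2` and help the contraction. -/
lemma SqLipschitz.exchangeAverage (hN : 3 ≤ N) {E L : ℝ} {g : (Fin N → ℝ) → ℝ}
    (hg : Continuous g) (hL : SqLipschitz E L g) :
    SqLipschitz E (L * contractionRate N) (exchangeAverage g) := by
  intro η hη ξ hξ
  have hN3 : (3 : ℝ) ≤ N := by exact_mod_cast hN
  have h0 : 0 < (N : ℝ) * (N - 1) := by nlinarith
  set d : Fin N → ℝ := fun k => η k - ξ k with hd
  have hd0 : ∑ k, d k = 0 := by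
    simp only [hd, Finset.sum_sub_distrib, hη.2, hξ.2, sub_self]
  set D := ∑ k, d k ^ 2 with hD
  have hsum : ∑ p ∈ (Finset.univ : Finset (Fin N)).offDiag,
      (D - (d p.1 ^ 2 + d p.2 ^ 2) + 2 / 3 * (d p.1 + d p.2) ^ 2) =
      (N * (N - 1) - 2 / 3 * (N + 1)) * D := by
    rw [sum_offDiag_eq fun i j => D - (d i ^ 2 + d j ^ 2) + 2 / 3 * (d i + d j) ^ 2]
    have e1 : ∀ i, ∑ j, (D - (d i ^ 2 + d j ^ 2) + 2 / 3 * (d i + d j) ^ 2) =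
        N * D - 1 / 3 * N * d i ^ 2 - 1 / 3 * D := by
      intro i
      have : ∀ j, D - (d i ^ 2 + d j ^ 2) + 2 / 3 * (d i + d j) ^ 2 =
          (D - 1 / 3 * d i ^ 2) - 1 / 3 * d j ^ 2 + 4 / 3 * d i * d j := fun j => by ring
      simp_rw [this]
      rw [Finset.sum_add_distrib, Finset.sum_sub_distrib, ← Finset.mul_sum, ← Finset.mul_sum, hd0]
      simp
      ring
    have e2 : ∀ i, D - (d i ^ 2 + d i ^ 2) + 2 / 3 * (d i + d i) ^ 2 = D + 2 / 3 * d i ^ 2 :=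
      fun i => by ring
    simp_rw [e1, e2]
    rw [Finset.sum_sub_distrib, Finset.sum_sub_distrib, Finset.sum_add_distrib]
    simp only [← Finset.mul_sum, ← hD, Finset.sum_const, Finset.card_univ, Fintype.card_fin, nsmul_eq_mul]
    ring
  set c := (N : ℝ) * (N - 1) with hc
  calc (StochasticExchange.exchangeAverage g η - StochasticExchange.exchangeAverage g ξ) ^ 2
      = c⁻¹ ^ 2 * (∑ p ∈ (Finset.univ : Finset (Fin N)).offDiag,
        (pairAverage p.1 p.2 g η - pairAverage p.1 p.2 g ξ)) ^ 2 := by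
        rw [StochasticExchange.exchangeAverage, StochasticExchange.exchangeAverage, ← mul_sub,
          ← Finset.sum_sub_distrib, mul_pow]
    _ ≤ c⁻¹ ^ 2 * (c * ∑ p ∈ (Finset.univ : Finset (Fin N)).offDiag,
        (pairAverage p.1 p.2 g η - pairAverage p.1 p.2 g ξ) ^ 2) := by
        gcongr
        refine (sq_sum_le_card_mul_sum_sq).trans_eq ?_
        rw [card_offDiag_fin]
    _ ≤ c⁻¹ ^ 2 * (c * ∑ p ∈ (Finset.univ : Finset (Fin N)).offDiag,
        L * (D - (d p.1 ^ 2 + d p.2 ^ 2) + 2 / 3 * (d p.1 + d p.2) ^ 2)) := by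
        gcongr with p hp
        exact sq_pairAverage_sub_le hg hL (Finset.mem_offDiag.1 hp).2.2 hη hξ
    _ = L * contractionRate N * D := by
        rw [← Finset.mul_sum, hsum, contractionRate, ← hc]
        field_simp

lemma sq_integral_mul_le (hN : N ≠ 0) {E : ℝ} (hE : 0 < E) {u v : (Fin N → ℝ) → ℝ}
    (hu : Continuous u) (hv : Continuous v) :
    (∫ η, u η * v η ∂uniformMeasure N E) ^ 2 ≤
      (∫ η, u η ^ 2 ∂uniformMeasure N E) * ∫ η, v η ^ 2 ∂uniformMeasure N E := by
  have hi := fun {w : (Fin N → ℝ) → ℝ} (hw : Continuous w) =>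
    integrable_of_continuous (E := E) hN hE hw
  have h : ∀ t : ℝ, 0 ≤ (∫ η, v η ^ 2 ∂uniformMeasure N E) * (t * t) +
      (2 * ∫ η, u η * v η ∂uniformMeasure N E) * t + ∫ η, u η ^ 2 ∂uniformMeasure N E := by
    intro t
    have h0 : 0 ≤ ∫ η, (u η + t * v η) ^ 2 ∂uniformMeasure N E :=
      integral_nonneg fun η => sq_nonneg _
    have e : ∀ η, (u η + t * v η) ^ 2 = u η ^ 2 + (2 * t * (u η * v η) + t ^ 2 * v η ^ 2) :=
      fun η => by ring
    simp_rw [e] at h0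
    rw [integral_add (hi (by fun_prop)) (hi (by fun_prop)), integral_add (hi (by fun_prop))
      (hi (by fun_prop)), integral_const_mul, integral_const_mul] at h0
    linarith
  have := discrim_le_zero h
  unfold discrim at this
  linarith

/-- A log-convex sequence of nonnegative reals that decays at least geometrically has its first
ratio bounded by the rate. -/
lemma le_mul_of_logConvex {m : ℕ → ℝ} (h0 : ∀ n, 0 ≤ m n)
    (hconv : ∀ n, m (n + 1) ^ 2 ≤ m n * m (n + 2)) {C r : ℝ} (hr : 0 < r)
    (hdecay : ∀ n, m n ≤ C * r ^ n) : m 1 ≤ r * m 0 := by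
  by_contra! hlt
  have hm0 : 0 < m 0 := by
    rcases (h0 0).eq_or_lt with h | h
    · have := hconv 0
      rw [← h, zero_mul] at this
      have h1 : 0 < m 1 := by rwa [← h, mul_zero] at hlt
      have := pow_pos h1 2
      simp at *
      linarith
    · exact h
  set ρ := m 1 / m 0 with hρ
  have hrρ : r < ρ := (lt_div_iff₀ hm0).2 hlt
  have hρ0 : 0 < ρ := hr.trans hrρ
  -- Log-convexity makes successive ratios nondecreasing, so a first ratio `ρ > r` forces growth at
  -- least like `ρ ^ n`.
  have hstep : ∀ n, 0 < m n ∧ ρ * m n ≤ m (n + 1) := by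
    intro n
    induction n with
    | zero => exact ⟨hm0, by rw [hρ, div_mul_cancel₀ _ hm0.ne']⟩
    | succ n ih =>
      have hpos : 0 < m (n + 1) := lt_of_lt_of_le (mul_pos hρ0 ih.1) ih.2
      refine ⟨hpos, ?_⟩
      have h1 := hconv n
      by_contra! hc
      have h2 : m n * m (n + 2) < m n * (ρ * m (n + 1)) := mul_lt_mul_of_pos_left hc ih.1
      nlinarith [mul_le_mul_of_nonneg_right ih.2 hpos.le]
  have hgrow : ∀ n, m 0 * ρ ^ n ≤ m n := by
    intro n
    induction n with
    | zero => simp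
    | succ n ih =>
      calc m 0 * ρ ^ (n + 1) = ρ * (m 0 * ρ ^ n) := by ring
        _ ≤ ρ * m n := by gcongr
        _ ≤ _ := (hstep n).2
  have hbd : ∀ n, (ρ / r) ^ n ≤ C / m 0 := by
    intro n
    rw [div_pow, div_le_div_iff₀ (pow_pos hr n) hm0]
    linarith [hgrow n, hdecay n]
  obtain ⟨n, hn⟩ := pow_unbounded_of_one_lt (C / m 0) ((one_lt_div hr).2 hrρ)
  exact absurd (hbd n) (not_le.2 hn)

lemma contractionRate_pos (hN : 3 ≤ N) : 0 < contractionRate N := by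
  have hN3 : (3 : ℝ) ≤ N := by exact_mod_cast hN
  have h0 : 0 < (N : ℝ) * (N - 1) := by nlinarith
  unfold contractionRate
  rw [sub_pos, ← div_eq_mul_inv, div_lt_one h0]
  nlinarith

/-- The spectral gap of the exchange at constant rate, for Lipschitz functions of mean zero. -/
lemma integral_mul_exchangeAverage_le (hN : 3 ≤ N) {E : ℝ} (hE : 0 < E) {L : ℝ}
    {g : (Fin N → ℝ) → ℝ} (hg : Continuous g) (hL : SqLipschitz E L g)
    (hg0 : ∫ η, g η ∂uniformMeasure N E = 0) :
    ∫ η, g η * exchangeAverage g η ∂uniformMeasure N E ≤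
      (1 + contractionRate N) / 2 * ∫ η, g η ^ 2 ∂uniformMeasure N E := by
  have hprob := isProbabilityMeasure_uniformMeasure (N := N) (by omega) hE
  set μ := uniformMeasure N E with hμ
  set r := contractionRate N with hr
  have hr0 : 0 < r := contractionRate_pos hN
  set A : ℕ → (Fin N → ℝ) → ℝ := fun n => exchangeAverage^[n] g with hA
  have hAs : ∀ n, A (n + 1) = exchangeAverage (A n) := fun n =>
    Function.iterate_succ_apply' _ _ _
  have hAc : ∀ n, Continuous (A n) := by
    intro n
    induction n with
    | zero => exact hg
    | succ n ih => rw [hAs]; exact continuous_exchangeAverage ih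
  have hAm : ∀ n, ∫ η, A n η ∂μ = 0 := by
    intro n
    induction n with
    | zero => exact hg0
    | succ n ih => rw [hAs, integral_exchangeAverage hN hE (hAc n), ih]
  have hAL : ∀ n, SqLipschitz E (L * r ^ n) (A n) := by
    intro n
    induction n with
    | zero => rw [pow_zero, mul_one]; exact hL
    | succ n ih =>
      rw [hAs, pow_succ, ← mul_assoc]
      exact ih.exchangeAverage hN (hAc n)
  set m : ℕ → ℝ := fun n => ∫ η, A n η ^ 2 ∂μ with hm
  -- By symmetry one factor of the operator moves across the inner product; Cauchy–Schwarz does the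
  -- rest.
  have hconv : ∀ n, m (n + 1) ^ 2 ≤ m n * m (n + 2) := by
    intro n
    have : m (n + 1) = ∫ η, A n η * A (n + 2) η ∂μ := by
      rw [hAs (n + 1), ← integral_exchangeAverage_mul hN hE (hAc n) (hAc (n + 1)), ← hAs]
      simp only [hm, sq, hμ]
    rw [this]
    exact sq_integral_mul_le (by omega) hE (hAc n) (hAc (n + 2))
  have hL0 : ∀ n, ∀ η ∈ stateSpace N E, ∀ ξ ∈ stateSpace N E,
      (A n η - A n ξ) ^ 2 ≤ |L| * (N * (N * E) ^ 2) * r ^ n := by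
    intro n η hη ξ hξ
    calc (A n η - A n ξ) ^ 2 ≤ L * r ^ n * ∑ k, (η k - ξ k) ^ 2 := hAL n η hη ξ hξ
      _ ≤ |L| * r ^ n * (N * (N * E) ^ 2) := by
        gcongr
        · exact le_abs_self L
        · calc ∑ k, (η k - ξ k) ^ 2 ≤ ∑ _k : Fin N, (N * E) ^ 2 := by
                refine Finset.sum_le_sum fun k _ => sq_le_sq' ?_ ?_ <;>
                linarith [hη.1 k, hξ.1 k, le_of_mem_stateSpace hη k, le_of_mem_stateSpace hξ k]
            _ = _ := by simp
      _ = _ := by ring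
  have hdecay : ∀ n, m n ≤ |L| * (N * (N * E) ^ 2) * r ^ n := by
    intro n
    set K := |L| * (N * (N * E) ^ 2) * r ^ n with hK
    have hpt : ∀ η ∈ stateSpace N E, A n η ^ 2 ≤ K := by
      intro η hη
      -- A function of mean zero is bounded by its oscillation, which the Lipschitz bound controls.
      have e : A n η = ∫ ξ, (A n η - A n ξ) ∂μ := by
        rw [integral_sub (integrable_const _) (integrable_of_continuous (by omega) hE (hAc n)),
          hAm n]
        simp
      have hc1 : Continuous fun ξ => A n η - A n ξ := continuous_const.sub (hAc n)
      have h1 := sq_integral_mul_le (N := N) (by omega) hE hc1 (continuous_const (y := (1 : ℝ)))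
      simp only [mul_one, one_pow] at h1
      rw [← hμ, ← e, integral_const, probReal_univ, one_smul, mul_one] at h1
      refine h1.trans ?_
      calc ∫ ξ, (A n η - A n ξ) ^ 2 ∂μ ≤ ∫ _ξ, K ∂μ := by
            refine integral_mono_ae (integrable_of_continuous (by omega) hE (hc1.pow 2))
              (integrable_const _) ?_
            filter_upwards [ae_mem_stateSpace N E] with ξ hξ using hL0 n η hη ξ hξ
        _ = K := by simp
    calc m n ≤ ∫ _ξ, K ∂μ := by
          refine integral_mono_ae (integrable_of_continuous (by omega) hE ((hAc n).pow 2))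
            (integrable_const _) ?_
          filter_upwards [ae_mem_stateSpace N E] with ξ hξ using hpt ξ hξ
      _ = K := by simp
  have hm0 : ∀ n, 0 ≤ m n := fun n => integral_nonneg fun η => sq_nonneg _
  have h1 := le_mul_of_logConvex hm0 hconv hr0 hdecay
  have h2 := sq_integral_mul_le (N := N) (by omega) hE hg (continuous_exchangeAverage hg)
  have h3 : (∫ η, g η * exchangeAverage g η ∂μ) ^ 2 ≤ m 0 * m 1 := h2
  have h4 : m 0 * m 1 ≤ m 0 * (r * m 0) := mul_le_mul_of_nonneg_left h1 (hm0 0)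
  -- The AM–GM bound `r ≤ ((1 + r) / 2) ^ 2` avoids the square root of `r`.
  have h5 : m 0 * m 1 ≤ ((1 + r) / 2 * m 0) ^ 2 := by
    nlinarith [sq_nonneg ((1 - r) * m 0)]
  exact le_of_abs_le (abs_le_of_sq_le_sq (h3.trans h5) (mul_nonneg (by linarith) (hm0 0)))

lemma sum_offDiag_eq_sum_ite {M : Type*} [AddCommMonoid M] (F : Fin N → Fin N → M) :
    ∑ p ∈ (Finset.univ : Finset (Fin N)).offDiag, F p.1 p.2 =
      ∑ i, ∑ j, if i = j then 0 else F i j := by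
  rw [← Finset.sum_product' Finset.univ Finset.univ fun i j => if i = j then 0 else F i j]
  refine Finset.sum_subset_zero_on_sdiff (fun p _ => by simp) (fun p hp => ?_) fun p hp => ?_
  · have : p.1 = p.2 := by simpa using hp
    simp [this]
  · rw [if_neg (Finset.mem_offDiag.1 hp).2.2]

lemma exchangeForm_sub_const {E : ℝ} (i j : Fin N) (w : (Fin N → ℝ) → ℝ≥0∞)
    (f : (Fin N → ℝ) → ℝ) (c : ℝ) :
    exchangeForm E i j w (fun η => f η - c) = exchangeForm E i j w f := by
  simp only [exchangeForm, sqDist, sub_sub_sub_cancel_right]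

/-- The spectral gap of the exchange at constant rate, for Lipschitz functions. -/
lemma variance_le_sum_exchangeForm (hN : 3 ≤ N) {E : ℝ} (hE : 0 < E) {L : ℝ}
    {g : (Fin N → ℝ) → ℝ} (hg : Continuous g) (hL : SqLipschitz E L g) :
    ENNReal.ofReal (2 / 3 * (N + 1) * (∫ η, g η ^ 2 ∂uniformMeasure N E -
        (∫ η, g η ∂uniformMeasure N E) ^ 2)) ≤
      ∑ p ∈ (Finset.univ : Finset (Fin N)).offDiag, exchangeForm E p.1 p.2 (fun _ => 1) g := by
  have hprob := isProbabilityMeasure_uniformMeasure (N := N) (by omega) hE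
  have hi := fun {w : (Fin N → ℝ) → ℝ} (hw : Continuous w) =>
    integrable_of_continuous (N := N) (by omega) hE hw
  set μ := uniformMeasure N E with hμ
  set c := ∫ η, g η ∂μ with hc
  set h : (Fin N → ℝ) → ℝ := fun η => g η - c with hh
  have hhc : Continuous h := hg.sub continuous_const
  have hhL : SqLipschitz E L h := by
    intro η hη ξ hξ
    simp only [hh, sub_sub_sub_cancel_right]
    exact hL η hη ξ hξ
  have hh0 : ∫ η, h η ∂μ = 0 := by
    rw [integral_sub (hi hg) (integrable_const _)]; simp [hc]
  have hvar : ∫ η, h η ^ 2 ∂μ = ∫ η, g η ^ 2 ∂μ - c ^ 2 := by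
    have : ∀ η, h η ^ 2 = g η ^ 2 - (2 * c * g η - c ^ 2) := fun η => by simp only [hh]; ring
    simp_rw [this]
    rw [integral_sub (hi (by fun_prop)) (hi (by fun_prop)), integral_sub (hi (by fun_prop))
      (integrable_const _), integral_const_mul, ← hc]
    simp; ring
  have hform : ∀ p ∈ (Finset.univ : Finset (Fin N)).offDiag,
      exchangeForm E p.1 p.2 (fun _ => 1) g = ENNReal.ofReal (2 * (∫ η, h η ^ 2 ∂μ -
        ∫ η, h η * pairAverage p.1 p.2 h η ∂μ)) ∧
      0 ≤ 2 * (∫ η, h η ^ 2 ∂μ - ∫ η, h η * pairAverage p.1 p.2 h η ∂μ) := by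
    intro p hp
    have hne := (Finset.mem_offDiag.1 hp).2.2
    obtain ⟨_, h2, h3⟩ := exchangeForm_eq_integral hN hE hne (φ := fun _ => 1) measurable_const
      (M := 1) (by simp) (by simp) hhc.measurable (memLp_of_continuous (by omega) hE hhc)
    have e : ∫ η, h η * (1 * (h η - pairAverage p.1 p.2 h η)) ∂μ =
        ∫ η, h η ^ 2 ∂μ - ∫ η, h η * pairAverage p.1 p.2 h η ∂μ := by
      have hc2 : Continuous fun η => h η * pairAverage p.1 p.2 h η :=
        hhc.mul (continuous_pairAverage _ _ hhc)
      have hc1 : Continuous fun η => h η ^ 2 := hhc.pow 2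
      rw [← integral_sub (hi hc1) (hi hc2)]
      congr 1; ext η; ring
    rw [e] at h2 h3
    rw [← h2, ← exchangeForm_sub_const _ _ _ g c]
    exact ⟨by simp [hh], by linarith⟩
  rw [Finset.sum_congr rfl fun p hp => (hform p hp).1,
    ← ENNReal.ofReal_sum_of_nonneg fun p hp => (hform p hp).2]
  refine ENNReal.ofReal_le_ofReal ?_
  have hgap := integral_mul_exchangeAverage_le hN hE hhc hhL hh0
  have hN3 : (3 : ℝ) ≤ N := by exact_mod_cast hN
  have hpos : 0 < (N : ℝ) * (N - 1) := by nlinarith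
  rw [integral_mul_exchangeAverage hN hE hhc hhc, ← hμ, contractionRate,
    inv_mul_le_iff₀ hpos] at hgap
  rw [← Finset.mul_sum, Finset.sum_sub_distrib, Finset.sum_const, nsmul_eq_mul, card_offDiag_fin,
    ← hvar]
  have e : (N : ℝ) * (N - 1) * ((1 + (1 - 2 / 3 * (N + 1) * ((N : ℝ) * (N - 1))⁻¹)) / 2 *
      ∫ η, h η ^ 2 ∂μ) = (N * (N - 1) - 1 / 3 * (N + 1)) * ∫ η, h η ^ 2 ∂μ := by
    have hcc := mul_inv_cancel₀ hpos.ne'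
    linear_combination (-(1 / 3) * (N + 1) * ∫ η, h η ^ 2 ∂μ) * hcc
  rw [e] at hgap
  linarith

/-! ### Extension of the constant-rate gap to `L²` -/

/-- The increment of `f` under an exchange, as an operator of `L²` spaces. -/
def increment (hN : 3 ≤ N) {E : ℝ} (hE : 0 < E) {i j : Fin N} (hij : i ≠ j) :
    Lp ℝ 2 (uniformMeasure N E) → Lp ℝ 2 ((uniformMeasure N E).prod unitUniform) :=
  fun f => Lp.compMeasurePreserving Prod.fst measurePreserving_fst f -
    Lp.compMeasurePreserving _ (measurePreserving_exchange hN hE hij) f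

lemma continuous_increment (hN : 3 ≤ N) {E : ℝ} (hE : 0 < E) {i j : Fin N} (hij : i ≠ j) :
    Continuous (increment hN hE hij) :=
  (Lp.isometry_compMeasurePreserving _).continuous.sub
    (Lp.isometry_compMeasurePreserving _).continuous

/-- Writes the constant-rate form as the squared norm of a continuous map on `L²`, so that it passes
to limits and does not depend on the representative. -/
lemma ofReal_norm_increment_sq (hN : 3 ≤ N) {E : ℝ} (hE : 0 < E) {i j : Fin N} (hij : i ≠ j)
    (f : Lp ℝ 2 (uniformMeasure N E)) {g : (Fin N → ℝ) → ℝ} (hg : Measurable g)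
    (hfg : f =ᵐ[uniformMeasure N E] g) :
    ENNReal.ofReal (‖increment hN hE hij f‖ ^ 2) = exchangeForm E i j (fun _ => 1) g := by
  have hprob := isProbabilityMeasure_uniformMeasure (N := N) (by omega) hE
  have hmp := measurePreserving_exchange hN hE hij
  have hfst : MeasurePreserving (Prod.fst : (Fin N → ℝ) × ℝ → _)
    ((uniformMeasure N E).prod unitUniform) (uniformMeasure N E) := measurePreserving_fst
  set F := increment hN hE hij f with hF
  have hae : F =ᵐ[(uniformMeasure N E).prod unitUniform]
      fun p => g p.1 - g (exchange i j p.2 p.1) := by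
    refine (Lp.coeFn_sub _ _).trans ?_
    filter_upwards [Lp.coeFn_compMeasurePreserving f hfst, Lp.coeFn_compMeasurePreserving f hmp,
      hfst.quasiMeasurePreserving.ae_eq_comp hfg, hmp.quasiMeasurePreserving.ae_eq_comp hfg]
      with p h1 h2 h3 h4
    rw [Pi.sub_apply, h1, h2, h3, h4]
    rfl
  rw [← real_inner_self_eq_norm_sq, L2.inner_def, ofReal_integral_eq_lintegral_ofReal
    (L2.integrable_inner F F) (Filter.Eventually.of_forall fun p => real_inner_self_nonneg)]
  have hm : Measurable fun p : (Fin N → ℝ) × ℝ => sqDist (g p.1) (g (exchange i j p.2 p.1)) :=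
    measurable_sqDist (hg.comp measurable_fst) (hg.comp (measurable_exchange i j))
  have : ∫⁻ p, ENNReal.ofReal (inner ℝ (F p) (F p)) ∂(uniformMeasure N E).prod unitUniform =
      ∫⁻ p, sqDist (g p.1) (g (exchange i j p.2 p.1)) ∂(uniformMeasure N E).prod unitUniform := by
    refine lintegral_congr_ae ?_
    filter_upwards [hae] with p hp
    rw [real_inner_self_eq_norm_sq, hp, sqDist, Real.norm_eq_abs, sq_abs]
  rw [this, lintegral_prod _ hm.aemeasurable]
  simp only [exchangeForm, one_mul]

lemma exists_sqLipschitz_of_contDiff {E : ℝ} {g : (Fin N → ℝ) → ℝ} (hg : ContDiff ℝ 1 g)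
    (hs : HasCompactSupport g) : ∃ L, SqLipschitz E L g := by
  obtain ⟨C, hC⟩ := hg.lipschitzWith_of_hasCompactSupport hs one_ne_zero
  refine ⟨C ^ 2, fun η _ ξ _ => ?_⟩
  have h1 := hC.dist_le_mul η ξ
  have h2 : dist η ξ ^ 2 ≤ ∑ k, (η k - ξ k) ^ 2 := by
    have hS : 0 ≤ ∑ k, (η k - ξ k) ^ 2 := Finset.sum_nonneg fun k _ => sq_nonneg _
    have : dist η ξ ≤ Real.sqrt (∑ k, (η k - ξ k) ^ 2) := by
      refine (dist_pi_le_iff (Real.sqrt_nonneg _)).2 fun k => ?_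
      rw [Real.dist_eq]
      refine Real.abs_le_sqrt ?_
      exact Finset.single_le_sum (f := fun k => (η k - ξ k) ^ 2) (fun k _ => sq_nonneg _)
        (Finset.mem_univ k)
    calc dist η ξ ^ 2 ≤ Real.sqrt (∑ k, (η k - ξ k) ^ 2) ^ 2 := by gcongr
      _ = _ := Real.sq_sqrt hS
  rw [Real.dist_eq] at h1
  calc (g η - g ξ) ^ 2 = |g η - g ξ| ^ 2 := (sq_abs _).symm
    _ ≤ (C * dist η ξ) ^ 2 := by gcongr
    _ = (C : ℝ) ^ 2 * dist η ξ ^ 2 := by ring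
    _ ≤ _ := by gcongr

/-- The spectral gap of the exchange at constant rate. -/
lemma norm_sq_le_sum_exchangeForm (hN : 3 ≤ N) {E : ℝ} (hE : 0 < E) :
    ∀ f : Lp ℝ 2 (uniformMeasure N E), ∫ η, f η ∂uniformMeasure N E = 0 →
    ENNReal.ofReal (2 / 3 * (N + 1) * ‖f‖ ^ 2) ≤
      ∑ p ∈ (Finset.univ : Finset (Fin N)).offDiag, exchangeForm E p.1 p.2 (fun _ => 1) f := by
  have hprob := isProbabilityMeasure_uniformMeasure (N := N) (by omega) hE
  set μ := uniformMeasure N E with hμ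
  set one : Lp ℝ 2 μ := Lp.const 2 μ (1 : ℝ) with hone
  have hmean : ∀ u : Lp ℝ 2 μ, inner ℝ one u = ∫ η, u η ∂μ := by
    intro u
    rw [L2.inner_def]
    refine integral_congr_ae ?_
    filter_upwards [Lp.coeFn_const (p := 2) (μ := μ) (1 : ℝ)] with η hη
    rw [hone, hη]; simp
  set J : Lp ℝ 2 μ → ℝ := fun u => ∑ p ∈ (Finset.univ : Finset (Fin N)).offDiag.attach,
    ‖increment hN hE (Finset.mem_offDiag.1 p.2).2.2 u‖ ^ 2 with hJ
  have hJform : ∀ (u : Lp ℝ 2 μ) (g : (Fin N → ℝ) → ℝ), Measurable g → u =ᵐ[μ] g →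
      ENNReal.ofReal (J u) = ∑ p ∈ (Finset.univ : Finset (Fin N)).offDiag,
        exchangeForm E p.1 p.2 (fun _ => 1) g := by
    intro u g hg hug
    rw [hJ, ENNReal.ofReal_sum_of_nonneg fun p _ => by positivity,
      ← Finset.sum_attach (Finset.univ : Finset (Fin N)).offDiag]
    exact Finset.sum_congr rfl fun p _ => ofReal_norm_increment_sq hN hE _ u hg hug
  -- The inequality is stated with the variance because the smooth approximants need not have mean
  -- zero.
  have hclosed : IsClosed {u : Lp ℝ 2 μ |
      2 / 3 * ((N : ℝ) + 1) * (‖u‖ ^ 2 - inner ℝ one u ^ 2) ≤ J u} := by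
    refine isClosed_le (by fun_prop) ?_
    exact continuous_finsetSum _ fun p _ => (continuous_increment hN hE _).norm.pow 2
  have hall : ∀ u : Lp ℝ 2 μ, 2 / 3 * ((N : ℝ) + 1) * (‖u‖ ^ 2 - inner ℝ one u ^ 2) ≤ J u := by
    intro u
    have hd := Lp.dense_hasCompactSupport_contDiff (F := ℝ) (μ := μ) (p := 2) (by simp)
    refine hclosed.closure_subset_iff.2 ?_ (hd u)
    rintro v ⟨g, hvg, hs, hg⟩
    have hgc := hg.continuous
    obtain ⟨L, hL⟩ := exists_sqLipschitz_of_contDiff (E := E) (hg.of_le (by norm_num)) hs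
    have h1 := variance_le_sum_exchangeForm hN hE hgc hL
    rw [← hJform v g hgc.measurable hvg] at h1
    have hJ0 : 0 ≤ J v := Finset.sum_nonneg fun p _ => by positivity
    rw [ENNReal.ofReal_le_ofReal_iff hJ0] at h1
    refine le_trans (le_of_eq ?_) h1
    have e1 : ‖v‖ ^ 2 = ∫ η, g η ^ 2 ∂μ := by
      rw [← real_inner_self_eq_norm_sq, L2.inner_def]
      refine integral_congr_ae ?_
      filter_upwards [hvg] with η hη
      rw [real_inner_self_eq_norm_sq, hη, Real.norm_eq_abs, sq_abs]
    rw [e1, hmean, integral_congr_ae hvg]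
  intro f hf0
  have := hall f
  rw [hmean, hf0] at this
  rw [← hJform f f (Lp.stronglyMeasurable f).measurable (Filter.EventuallyEq.refl _ _)]
  refine ENNReal.ofReal_le_ofReal (le_trans (le_of_eq ?_) this)
  ring

/-! ### The Dirichlet form at exponent `γ` -/

lemma sum_offDiag_eq_two_mul {F : Fin N → Fin N → ℝ} (hF : ∀ i j, i ≠ j → F i j = F j i) :
    ∑ p ∈ (Finset.univ : Finset (Fin N)).offDiag, F p.1 p.2 =
      2 * ∑ i, ∑ j ∈ Finset.Ioi i, F i j := by
  have h1 : ∀ i j, (if i = j then 0 else F i j) =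
      (if i < j then F i j else 0) + (if j < i then F j i else 0) := by
    intro i j
    rcases lt_trichotomy i j with h | h | h
    · simp [h, h.ne, h.not_gt]
    · simp [h]
    · simp [h, h.ne', h.not_gt, hF i j h.ne']
  have h2 : ∀ i, ∑ j ∈ Finset.Ioi i, F i j = ∑ j, if i < j then F i j else 0 := by
    intro i
    rw [← Finset.sum_filter]
    congr 1; ext j; simp
  rw [sum_offDiag_eq_sum_ite]
  simp_rw [h1, h2, Finset.sum_add_distrib]
  rw [Finset.sum_comm (f := fun i j => if j < i then F j i else 0)]
  ring

/-- Since `γ - 1 ≤ 0`, the power `s ^ (γ - 1)` is smallest at `s = T`. With `T = N` this compares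
the rate at exponent `γ` with the rate at exponent `1`. -/
lemma rpow_sub_one_mul_le {γ T s : ℝ} (hγ : γ ≤ 1) (hs : 0 ≤ s) (hsT : s ≤ T) :
    T ^ (γ - 1) * s ≤ s ^ γ := by
  rcases hs.eq_or_lt with rfl | hs
  · rw [mul_zero]; exact Real.rpow_nonneg le_rfl _
  · calc T ^ (γ - 1) * s ≤ s ^ (γ - 1) * s := by
          gcongr ?_ * s
          exact Real.rpow_le_rpow_of_nonpos hs hsT (by linarith)
      _ = s ^ γ := by
          rw [Real.rpow_sub_one hs.ne', div_mul_cancel₀ _ hs.ne']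

lemma dirichletForm_eq (hN : 3 ≤ N) {γ : ℝ} {f : (Fin N → ℝ) → ℝ}
    (hint : ∀ i j : Fin N, i ≠ j → Integrable
      (fun η => f η * ((η i + η j) ^ γ * (f η - pairAverage i j f η))) (uniformMeasure N 1)) :
    dirichletForm γ N 1 f = ((N : ℝ) - 1)⁻¹ *
      ∑ p ∈ (Finset.univ : Finset (Fin N)).offDiag, ∫ η, f η *
        ((η p.1 + η p.2) ^ γ * (f η - pairAverage p.1 p.2 f η)) ∂uniformMeasure N 1 := by
  have hN3 : (3 : ℝ) ≤ N := by exact_mod_cast hN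
  rw [sum_offDiag_eq_two_mul (F := fun i j => ∫ η, f η *
    ((η i + η j) ^ γ * (f η - pairAverage i j f η)) ∂uniformMeasure N 1)]
  · rw [dirichletForm, ← integral_neg]
    -- The `2` is absorbed in passing from pairs `i < j` to ordered pairs.
    have hK : (N : ℝ) * ((N.choose 2 : ℕ) : ℝ)⁻¹ = ((N : ℝ) - 1)⁻¹ * 2 := by
      have h1 : (N : ℝ) - 1 ≠ 0 := by linarith
      have h2 : (N : ℝ) ≠ 0 := by linarith
      rw [Nat.cast_choose_two]
      field_simp
    have e : ∀ η, -(f η * generator γ N f η) = ((N : ℝ) - 1)⁻¹ * (2 *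
        ∑ i : Fin N, ∑ j ∈ Finset.Ioi i,
          f η * ((η i + η j) ^ γ * (f η - pairAverage i j f η))) := by
      intro η
      rw [generator, hK]
      simp_rw [← Finset.mul_sum]
      ring
    simp_rw [e]
    have hne : ∀ i : Fin N, ∀ j ∈ Finset.Ioi i, i ≠ j := fun i j hj => (Finset.mem_Ioi.1 hj).ne
    rw [integral_const_mul, integral_const_mul, integral_finsetSum]
    · congr 2
      refine Finset.sum_congr rfl fun i _ => ?_
      rw [integral_finsetSum]
      exact fun j hj => hint i j (hne i j hj)
    · exact fun i _ => integrable_finsetSum _ fun j hj => hint i j (hne i j hj)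
  · intro i j hij
    simp_rw [pairAverage_comm hij, add_comm]

/-- Chains the two rate comparisons with the constant-rate gap. The constant is `1 / 243 = (2 / 3) /
(2 * 81)`, where `2` comes from the exchange form being twice a Dirichlet form; the remaining `(N +
1) / (N - 1)` is at least `1`. -/
lemma le_dirichletForm {γ : ℝ} (hγ : γ ∈ Icc (0 : ℝ) 1) (hN : 3 ≤ N)
    (f : Lp ℝ 2 (uniformMeasure N 1)) (hf0 : ∫ η, f η ∂uniformMeasure N 1 = 0) :
    1 / 243 * (N : ℝ) ^ (γ - 1) * ‖f‖ ^ 2 ≤ dirichletForm γ N 1 f := by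
  have hN3 : (3 : ℝ) ≤ N := by exact_mod_cast hN
  have hfm : Measurable f := (Lp.stronglyMeasurable f).measurable
  have hform := fun {i j : Fin N} (hij : i ≠ j) => exchangeForm_eq_integral hN one_pos hij
    (φ := fun s => s ^ γ) (by fun_prop) (M := ((N : ℝ) * 1) ^ γ)
    (fun s hs => Real.rpow_nonneg hs.1 γ) (fun s hs => Real.rpow_le_rpow hs.1 hs.2 hγ.1)
    hfm (Lp.memLp f)
  rw [dirichletForm_eq hN fun i j hij => (hform hij).1]
  set I : Fin N × Fin N → ℝ := fun p => ∫ η, f η *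
    ((η p.1 + η p.2) ^ γ * (f η - pairAverage p.1 p.2 f η)) ∂uniformMeasure N 1 with hI
  have hI0 : ∀ p ∈ (Finset.univ : Finset (Fin N)).offDiag, 0 ≤ I p := fun p hp =>
    (hform (Finset.mem_offDiag.1 hp).2.2).2.2
  set c := (N : ℝ) ^ (γ - 1) with hc
  have hc0 : 0 ≤ c := Real.rpow_nonneg (by linarith) _
  have hcmp : ∀ p ∈ (Finset.univ : Finset (Fin N)).offDiag, ENNReal.ofReal c *
      exchangeForm 1 p.1 p.2 (fun η => ENNReal.ofReal (η p.1 + η p.2)) f ≤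
      ENNReal.ofReal (2 * I p) := by
    intro p hp
    have hne := (Finset.mem_offDiag.1 hp).2.2
    rw [hI, ← (hform hne).2.1]
    have : ENNReal.ofReal c *
        exchangeForm 1 p.1 p.2 (fun η => ENNReal.ofReal (η p.1 + η p.2)) f =
        exchangeForm 1 p.1 p.2 (fun η => ENNReal.ofReal (c * (η p.1 + η p.2))) f := by
      simp only [exchangeForm, ENNReal.ofReal_mul hc0, mul_assoc]
      rw [lintegral_const_mul' _ _ ENNReal.ofReal_ne_top]
    rw [this]
    refine exchangeForm_mono fun η hη => ENNReal.ofReal_le_ofReal ?_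
    refine rpow_sub_one_mul_le hγ.2 (add_nonneg (hη.1 _) (hη.1 _)) ?_
    simpa using add_le_of_mem_stateSpace hη hne
  have hgap := norm_sq_le_sum_exchangeForm hN one_pos f hf0
  have hthree := sum_exchangeForm_one_le hN hfm
  rw [← sum_offDiag_eq_sum_ite fun i j => exchangeForm 1 i j (fun _ => 1) f,
    ← sum_offDiag_eq_sum_ite fun i j =>
      exchangeForm 1 i j (fun η => ENNReal.ofReal (η i + η j)) f] at hthree
  have hchain : ENNReal.ofReal (c * (2 / 3 * (N + 1) * ‖f‖ ^ 2)) ≤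
      ENNReal.ofReal (81 * ∑ p ∈ (Finset.univ : Finset (Fin N)).offDiag, 2 * I p) := by
    rw [ENNReal.ofReal_mul hc0, ENNReal.ofReal_mul (p := 81) (by norm_num),
      ENNReal.ofReal_sum_of_nonneg fun p hp => mul_nonneg zero_le_two (hI0 p hp)]
    calc _ ≤ ENNReal.ofReal c * (81 * ∑ p ∈ (Finset.univ : Finset (Fin N)).offDiag,
          exchangeForm 1 p.1 p.2 (fun η => ENNReal.ofReal (η p.1 + η p.2)) f) := by
          gcongr
          exact hgap.trans hthree
      _ = 81 * ∑ p ∈ (Finset.univ : Finset (Fin N)).offDiag, ENNReal.ofReal c *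
          exchangeForm 1 p.1 p.2 (fun η => ENNReal.ofReal (η p.1 + η p.2)) f := by
          rw [← Finset.mul_sum]; ring
      _ ≤ _ := by
          rw [ENNReal.ofReal_ofNat]
          gcongr with p hp
          exact hcmp p hp
  have hS : 0 ≤ ∑ p ∈ (Finset.univ : Finset (Fin N)).offDiag, I p := Finset.sum_nonneg hI0
  rw [← Finset.mul_sum, ENNReal.ofReal_le_ofReal_iff (by positivity)] at hchain
  have hN1 : 0 < (N : ℝ) - 1 := by linarith
  rw [inv_mul_eq_div, le_div_iff₀ hN1]
  nlinarith [mul_nonneg hc0 (sq_nonneg ‖f‖)]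

/-! ### Admissible functions exist, and the conclusion -/

lemma uniformMeasure_hyperplane (hN : 2 ≤ N) (E c : ℝ) :
    uniformMeasure N E {η | η ⟨0, by omega⟩ = c} = 0 := by
  obtain ⟨n, rfl⟩ : ∃ n, N = n + 1 + 1 := ⟨N - 2, by omega⟩
  have hm : MeasurableSet {η : Fin (n + 1 + 1) → ℝ | η ⟨0, by omega⟩ = c} :=
    measurableSet_eq_fun (by fun_prop) measurable_const
  rw [uniformMeasure, Measure.map_apply (continuous_chart _ _).measurable hm]
  refine ProbabilityTheory.cond_absolutelyContinuous ?_
  exact Measure.pi_hyperplane (fun _ : Fin (n + 1) => (volume : Measure ℝ)) 0 c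

/-- The real infimum of an empty set is `0`, so a lower bound on the gap needs an admissible
function. A centred coordinate, normalized, serves: it is not almost surely constant because
hyperplanes fixing that coordinate are null. -/
lemma exists_norm_eq_one (hN : 3 ≤ N) : ∃ f : Lp ℝ 2 (uniformMeasure N 1),
    ‖f‖ = 1 ∧ ∫ η, f η ∂uniformMeasure N 1 = 0 := by
  have hprob := isProbabilityMeasure_uniformMeasure (N := N) (by omega) one_pos
  set k : Fin N := ⟨0, by omega⟩ with hk
  set c := ∫ η, η k ∂uniformMeasure N 1 with hc
  have hcont : Continuous fun η : Fin N → ℝ => η k - c := by fun_prop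
  have hmem := memLp_of_continuous (N := N) (by omega) one_pos hcont
  set u := hmem.toLp with hu
  have hu0 : ‖u‖ ≠ 0 := by
    intro h
    have h1 : u =ᵐ[uniformMeasure N 1] 0 := by
      rw [norm_eq_zero.1 h]; exact Lp.coeFn_zero _ _ _
    have h2 : ∀ᵐ η ∂uniformMeasure N 1, η k = c := by
      filter_upwards [h1, hmem.coeFn_toLp] with η h3 h4
      rw [h4] at h3
      exact sub_eq_zero.1 h3
    have h3 : ∀ᵐ η ∂uniformMeasure N 1, η k ≠ c :=
      measure_eq_zero_iff_ae_notMem.1 (uniformMeasure_hyperplane (by omega) 1 c)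
    have h4 : ∀ᵐ _η ∂uniformMeasure N 1, False := by
      filter_upwards [h2, h3] with η h5 h6 using h6 h5
    simp at h4
    exact IsProbabilityMeasure.ne_zero _ h4
  refine ⟨‖u‖⁻¹ • u, ?_, ?_⟩
  · rw [norm_smul, norm_inv, norm_norm, inv_mul_cancel₀ hu0]
  · rw [integral_congr_ae (Lp.coeFn_smul _ _)]
    simp only [Pi.smul_apply, integral_smul]
    rw [integral_congr_ae hmem.coeFn_toLp,
      integral_sub (integrable_of_continuous (by omega) one_pos (continuous_apply k))
        (integrable_const _), ← hc]
    simp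

end StochasticExchange

end

theorem lemma2p3 (γ : ℝ) (hγ : γ ∈ Set.Icc (0 : ℝ) 1) :
    ∃ C : ℝ, 0 < C ∧ ∀ N : ℕ, 3 ≤ N →
      C * (N : ℝ) ^ (γ - 1) ≤ StochasticExchange.spectralGap γ N := by
  refine ⟨1 / 243, by norm_num, fun N hN => ?_⟩
  obtain ⟨f, hf1, hf0⟩ := StochasticExchange.exists_norm_eq_one hN
  refine le_csInf ⟨_, f, hf1, hf0, rfl⟩ ?_
  rintro a ⟨g, hg1, hg0, rfl⟩
  simpa [hg1] using StochasticExchange.le_dirichletForm hγ hN g hg0
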